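/- **Model.** Let $n\ge 3$. The ring has nodes $\mathbb Z/n$ (anonymous to the robots), $x$ being joined to $x\pm1$; $x+1$ is the clockwise (CW) and $x-1$ the counterclockwise (CCW) neighbour of $x$. For a direction $D$, $d_D(x,y)$ is the number of hops from $x$ to $y$ in direction $D$; the distance of two nodes is $\min(d_{CW},d_{CCW})$. On a 1-interval connected ring an adversary removes at most one edge in each round. There are $l$ robots with distinct labels, initially all on one node (the root), and they agree on the clockwise direction. In every round all robots simultaneously (i) look: each sees, relative to its own position, which nodes hold no robot (null), exactly one robot (singleton) or several robots (multiplicity), which edge (if any) is missing in this round, its own label and the labels of the robots on its node; (ii) compute, by the same deterministic function of this view (no persistent memory), whether to move and in which direction; (iii) move one hop in the chosen direction, unless that edge is missing. Distance-$k$-dispersion (D-$k$-D) is solved if every occupied node holds exactly one robot, any two occupied nodes have distance at least $k$, and some two have distance exactly $k$. An execution terminates in $T$ rounds if $T$ is the least round such that D-$k$-D is solved at round $T$ and no robot moves from then on. **Chains and blocks.** Let $D$ be a direction and let $v[s]$ denote the node $s$ hops from $v$ in direction $D$. The *$D$-chain* of a multiplicity node $v$ is an arc $v[-1],v[0],\dots,v[a+1]$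 such that $v[a]$ is occupied, $v[a+1]$ is null, occupied nodes that are consecutive on the arc are $k$ hops apart, and the next occupied node from $v[a]$ in direction $D$ is more than $k$ hops away; a robot is *on* this chain if its node is one of $v[0],\dots,v[a]$. A *chain configuration* is one with a CW-chain and a CCW-chain of the same multiplicity node. A chain is *bad* if it contains the missing edge, else *good*. If there is no multiplicity node and exactly one ordered pair $(x,y)$ of distinct occupied nodes with $d_{CW}(x,y)<k$, then $x$ is the *head*. A *block head* is a multiplicity node or the head. A *block* in direction $D$ is an arc $v[0],\dots,v[a+1]$ such that $v$ is a block head, $v[a]$ is occupied, $v[a+1]$ is null, the next occupied node from $v[a]$ in direction $D$ is more than $k$ hops away, and either all consecutive occupied nodes on it are $k$ hops apart (*chain block*), or the first occupied node after $v$ on it is less than $k$ hops from $v$ and from there on consecutive occupied nodes are $k$ hops apart (*non-chain block*). **Algorithm D-$k$-D DynamicRing.** In each round: *If the configuration is a chain configuration* (Spread), let $D$ be CCW if both chains are good, the direction of the good chain if exactly one chain is bad, and the direction in which the multiplicity node has no adjacent missing edge if both are bad; the robot with the least label on the multiplicity node and all singleton robots on the $D$-chain move in direction $D$. *Otherwise*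 (ReconstructChain): if the missing edge (if any) is not in the chain block, the robots on the block head and on the chain block move in the direction of the chain block; if the missing edge is in the chain block, the robots on the non-chain block, other than those on the block head, move away from the block head. All other robots stay; in particular no robot moves if there is no block. **Theorem.** Algorithm D-$k$-D DynamicRing terminates in $\Theta(n)$ rounds on any 1-interval connected ring with $n$ nodes, and it is time-optimal. Precisely, there are absolute constants $c,C>0$ such that for all $n\ge3$, $k\ge1$, $l\ge2$ with $lk\le n$, all labels, every root and every 1-interval connected ring on $n$ nodes: 1. the execution of D-$k$-D DynamicRing with $l$ robots solves D-$k$-D and terminates in some number $T\le Cn$ of rounds, and $T\ge cn$ if $l=\lfloor n/k\rfloor$ (the largest possible number of robots); 2. if $l=\lfloor n/k\rfloor$, then every execution of any algorithm of the model that solves D-$k$-D and terminates in $T$ rounds has $T\ge cn$. -/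

import Mathlib

namespace DynRing

/-! ## The ring

The nodes of the ring are the elements of `ZMod n`; `x + 1` is the clockwise neighbour of `x`.
The edge named `e : ZMod n` joins the nodes `e` and `e + 1`. -/

/-- The two directions on the ring. -/
inductive Dir : Type
  | cw : Dir
  | ccw : Dir

/-- The displacement of one hop in direction `D`. -/
def Dir.step (n : ℕ) : Dir → ZMod n
  | .cw => 1
  | .ccw => -1

/-- The node reached from `x` after `s` hops in direction `D`. -/
def walk {n : ℕ} (x : ZMod n) (D : Dir) (s : ℕ) : ZMod n := x + (s : ZMod n) * D.step n

/-- The (name of the) edge that is traversed by one hop from `x` in direction `D`. -/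
def edgeFrom {n : ℕ} (x : ZMod n) : Dir → ZMod n
  | .cw => x
  | .ccw => x - 1

/-- The distance from `x` to `y` in direction `D`. -/
def dirDist {n : ℕ} (D : Dir) (x y : ZMod n) : ℕ :=
  match D with
  | .cw => (y - x).val
  | .ccw => (x - y).val

/-- The (shortest) distance between two nodes of the ring. -/
def ringDist {n : ℕ} (x y : ZMod n) : ℕ := min (dirDist .cw x y) (dirDist .ccw x y)

/-- A 1-interval connected dynamic ring: in every round at most one edge of the ring is missing;
`G t` is the edge missing in round `t`, if there is one. -/
abbrev DynamicRing (n : ℕ) : Type := ℕ → Option (ZMod n)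

/-! ## Robots, views, algorithms, executions -/

/-- What weak global multiplicity detection tells about a node:
no robot, exactly one robot, more than one robot. -/
inductive Occ : Type
  | null : Occ
  | single : Occ
  | multi : Occ

/-- The snapshot obtained by a robot in its Look phase. Nodes are anonymous: the observer's own
node is `0`, and nodes and edges are named by their clockwise offset from it
(the robots have chirality and see the whole ring). -/
structure View (n : ℕ) : Type where
  /-- the occupancy of every node -/
  occ : ZMod n → Occ
  /-- the edge missing in the current round, if any -/
  missing : Option (ZMod n)
  /-- the label (ID) of the observer -/
  label : ℕ
  /-- the labels of all robots on the node of the observer, itself included -/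
  here : Finset ℕ

/-- A deterministic algorithm for identical robots without persistent memory: the snapshot
determines whether the robot tries to move and in which direction. -/
abbrev Algorithm (n : ℕ) : Type := View n → Option Dir

/-- A placement of `l` robots on the nodes of the ring. -/
abbrev Placement (n l : ℕ) : Type := Fin l → ZMod n

/-- The occupancy of a node: null node, singleton node or multiplicity node. -/
def occupancy {n l : ℕ} (pos : Placement n l) (v : ZMod n) : Occ :=
  match (Finset.univ.filter (fun r => pos r = v)).card with
  | 0 => .null
  | 1 => .single
  | _ + 2 => .multi

/-- The snapshot of robot `r` when the robots are placed according to `pos` and the edge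
`missing` (if any) is missing. -/
def look {n l : ℕ} (label : Fin l → ℕ) (pos : Placement n l) (missing : Option (ZMod n))
    (r : Fin l) : View n where
  occ := fun v => occupancy pos (pos r + v)
  missing := missing.map (fun e => e - pos r)
  label := label r
  here := (Finset.univ.filter (fun r' => pos r' = pos r)).image label

/-- The Move phase of one robot: it moves one hop in its chosen direction, unless the edge in
that direction is missing. -/
def moveRobot {n : ℕ} (x : ZMod n) (missing : Option (ZMod n)) : Option Dir → ZMod n
  | none => x
  | some D => if missing = some (edgeFrom x D) then x else x + D.step n

/-- The placement at the beginning of round `t` when all robots start on the node `root` and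
execute the algorithm `A` on the dynamic ring `G` under the fully synchronous scheduler. -/
def execution {n l : ℕ} (A : Algorithm n) (label : Fin l → ℕ) (root : ZMod n)
    (G : DynamicRing n) : ℕ → Placement n l
  | 0 => fun _ => root
  | t + 1 => fun r =>
      moveRobot (execution A label root G t r) (G t)
        (A (look label (execution A label root G t) (G t) r))

/-- The placement solves distance-`k`-dispersion: every occupied node holds exactly one robot,
any two occupied nodes are at distance at least `k`, and some two of them are at distance
exactly `k`. -/
def IsDistanceDispersed {n l : ℕ} (k : ℕ) (pos : Placement n l) : Prop :=
  Function.Injective pos ∧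
  (∀ r r' : Fin l, r ≠ r' → k ≤ ringDist (pos r) (pos r')) ∧
  ∃ r r' : Fin l, r ≠ r' ∧ ringDist (pos r) (pos r') = k

/-- By round `T` distance-`k`-dispersion is solved for good: no robot moves any more. -/
def TerminatedBy {n l : ℕ} (k : ℕ) (C : ℕ → Placement n l) (T : ℕ) : Prop :=
  IsDistanceDispersed k (C T) ∧ ∀ t, T ≤ t → C t = C T

/-- The execution `C` solves distance-`k`-dispersion and terminates in exactly `T` rounds. -/
def TerminatesIn {n l : ℕ} (k : ℕ) (C : ℕ → Placement n l) (T : ℕ) : Prop :=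
  IsLeast {T' : ℕ | TerminatedBy k C T'} T

/-! ## Chains -/

section Shapes

variable {n : ℕ}

/-- The occupied nodes `walk x D s` and `walk x D t` are consecutive on the arc that starts
in `x` and runs in direction `D`. -/
def Consecutive (occ : ZMod n → Occ) (x : ZMod n) (D : Dir) (s t : ℕ) : Prop :=
  s < t ∧ occ (walk x D s) ≠ .null ∧ occ (walk x D t) ≠ .null ∧
    ∀ r, s < r → r < t → occ (walk x D r) = .null

/-- The nearest other occupied node from `w` in direction `D` is more than `k` hops away. -/
def FarFromNext (occ : ZMod n → Occ) (k : ℕ) (w : ZMod n) (D : Dir) : Prop :=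
  ∀ p, 0 < p → p < n → occ (walk w D p) ≠ .null → k < p

/-- The edge `missing` is one of the first `m` edges of the arc that starts in `x` and runs in
direction `D`. -/
def MissingOnArc (missing : Option (ZMod n)) (x : ZMod n) (D : Dir) (m : ℕ) : Prop :=
  ∃ s < m, missing = some (edgeFrom (walk x D s) D)

/-- The node one hop behind `v` with respect to direction `D`. -/
def behind (v : ZMod n) (D : Dir) : ZMod n := v - D.step n

/-- The chain in direction `D` whose multiplicity node is `v` and whose last occupied node is
`walk v D a`. It is the arc of `a + 2` edges from `behind v D` to the null node
`walk v D (a + 1)`. -/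
def IsChain (occ : ZMod n → Occ) (k : ℕ) (D : Dir) (v : ZMod n) (a : ℕ) : Prop :=
  a < n ∧ occ v = .multi ∧ occ (walk v D a) ≠ .null ∧ occ (walk v D (a + 1)) = .null ∧
  (∀ s t, t ≤ a + 2 → Consecutive occ (behind v D) D s t → t - s = k) ∧
  FarFromNext occ k (walk v D a) D

/-- A chain configuration contains a clockwise and a counterclockwise chain, which start from
the same multiplicity node. -/
def IsChainConfig (occ : ZMod n → Occ) (k : ℕ) : Prop :=
  ∃ v a b, IsChain occ k .cw v a ∧ IsChain occ k .ccw v b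

/-- The chain in direction `D` is bad: it contains the missing edge. -/
def BadChain (V : View n) (k : ℕ) (D : Dir) : Prop :=
  ∃ v a, IsChain V.occ k D v a ∧ MissingOnArc V.missing (behind v D) D (a + 2)

/-- The observer is on the chain in direction `D`, that is, on the part of it that leads from
the multiplicity node in direction `D`. -/
def OnChain (V : View n) (k : ℕ) (D : Dir) : Prop :=
  ∃ v a, IsChain V.occ k D v a ∧ ∃ s ≤ a, walk v D s = 0

/-! ## Blocks -/

/-- The node `v` is the head of a dispersed configuration: there is exactly one pair of (distinct)
occupied nodes with clockwise distance less than `k`, and `v` is its first node. -/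
def IsHead (occ : ZMod n → Occ) (k : ℕ) (v : ZMod n) : Prop :=
  (∀ x, occ x ≠ .multi) ∧
  ∃ w, (v ≠ w ∧ occ v ≠ .null ∧ occ w ≠ .null ∧ dirDist .cw v w < k) ∧
    ∀ x y, x ≠ y → occ x ≠ .null → occ y ≠ .null → dirDist .cw x y < k → x = v ∧ y = w

/-- A block starts at a multiplicity node or at the head. -/
def IsBlockHead (occ : ZMod n → Occ) (k : ℕ) (v : ZMod n) : Prop :=
  occ v = .multi ∨ IsHead occ k v

/-- What chain blocks and non-chain blocks have in common: the arc of `a + 1` edges from the block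
head `v` in direction `D` to the null node `walk v D (a + 1)`, with last occupied node
`walk v D a`, which is more than `k` hops away from the next occupied node. (Together with the
spacing conditions below, this determines `a`, so the arc is automatically a maximal one.) -/
def IsBlockArc (occ : ZMod n → Occ) (k : ℕ) (D : Dir) (v : ZMod n) (a : ℕ) : Prop :=
  a < n ∧ IsBlockHead occ k v ∧ occ (walk v D a) ≠ .null ∧ occ (walk v D (a + 1)) = .null ∧
  FarFromNext occ k (walk v D a) D

/-- A chain block: any two consecutive occupied nodes on it are at distance `k`. -/
def IsChainBlock (occ : ZMod n → Occ) (k : ℕ) (D : Dir) (v : ZMod n) (a : ℕ) : Prop :=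
  IsBlockArc occ k D v a ∧ ∀ s t, t ≤ a + 1 → Consecutive occ v D s t → t - s = k

/-- A non-chain block: the occupied node following the block head is at distance less than `k`
from it, and from there on consecutive occupied nodes are at distance `k`. -/
def IsNonChainBlock (occ : ZMod n → Occ) (k : ℕ) (D : Dir) (v : ZMod n) (a : ℕ) : Prop :=
  IsBlockArc occ k D v a ∧
  ∃ z, z ≤ a ∧ Consecutive occ v D 0 z ∧ z < k ∧
    ∀ s t, z ≤ s → t ≤ a + 1 → Consecutive occ v D s t → t - s = k

/-- The missing edge is in the chain block. -/
def MissingInChainBlock (V : View n) (k : ℕ) : Prop :=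
  ∃ D v a, IsChainBlock V.occ k D v a ∧ MissingOnArc V.missing v D (a + 1)

/-- The observer is on a block head from which a chain block runs in direction `D`. -/
def OnHeadOfChainBlock (V : View n) (k : ℕ) (D : Dir) : Prop :=
  ∃ a, IsChainBlock V.occ k D 0 a

/-- The observer is on the chain block, which runs in direction `D`. -/
def OnChainBlock (V : View n) (k : ℕ) (D : Dir) : Prop :=
  ∃ v a, IsChainBlock V.occ k D v a ∧ ∃ s ≤ a, walk v D s = 0

/-- The observer is on the non-chain block, which runs in direction `D`. -/
def OnNonChainBlock (V : View n) (k : ℕ) (D : Dir) : Prop :=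
  ∃ v a, IsNonChainBlock V.occ k D v a ∧ ∃ s ≤ a, walk v D s = 0

/-! ## The algorithm -/

open Classical in
/-- The direction with property `P`, if there is one. -/
noncomputable def dirWith (P : Dir → Prop) : Option Dir :=
  if P .cw then some .cw else if P .ccw then some .ccw else none

open Classical in
/-- The direction chosen in `spread`: counterclockwise if both chains are good, the direction of
the good chain if exactly one chain is bad, and the direction in which the multiplicity node has no
adjacent missing edge if both chains are bad. -/
noncomputable def spreadDir (V : View n) (k : ℕ) : Dir :=
  if ¬ BadChain V k .cw ∧ ¬ BadChain V k .ccw then .ccw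
  else if ¬ BadChain V k .cw then .cw
  else if ¬ BadChain V k .ccw then .ccw
  else if ∃ v, V.occ v = .multi ∧ V.missing = some (edgeFrom v .cw) then .ccw
  else .cw

open Classical in
/-- The subroutine Spread: the robot with least label on the multiplicity node and the singleton
robots on the chain in the chosen direction move in that direction. -/
noncomputable def spread (k : ℕ) (V : View n) : Option Dir :=
  if V.occ 0 = .multi then
    if ∀ m ∈ V.here, V.label ≤ m then some (spreadDir V k) else none
  else if OnChain V k (spreadDir V k) then some (spreadDir V k) else none

open Classical in
/-- The subroutine ReconstructChain: if the missing edge (if any) is not in the chain block, then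
the robots on the block head and on the chain block move in the direction of the chain block;
otherwise the robots on the non-chain block, except those on the block head, move away from the
block head. -/
noncomputable def reconstructChain (k : ℕ) (V : View n) : Option Dir :=
  if IsBlockHead V.occ k 0 then
    if ¬ MissingInChainBlock V k then dirWith (OnHeadOfChainBlock V k) else none
  else if ¬ MissingInChainBlock V k then dirWith (OnChainBlock V k)
  else dirWith (OnNonChainBlock V k)

open Classical in
/-- The algorithm D-k-D DynamicRing. -/
noncomputable def dkdDynamicRing (n k : ℕ) : Algorithm n := fun V =>
  if IsChainConfig V.occ k then spread k V else reconstructChain k V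

end Shapes

end DynRing

/-! The running time does not depend on the adversary: the algorithm stops after exactly `(l - 1) *
k` rounds. In every round up to then the occupied nodes form a line of `a + b + 1` nodes with all
spacings `k`, except that one spacing, next to an origin `v`, has some length `j` with `1 ≤ j ≤ k`;
only `v` may hold several robots (`Arranged`, with the convention `j = k` if `a = 0`). Each round
raises `(a + b) * k + j` by exactly one.

If `j < k`, the configuration is not a chain configuration, and `v` is the block head, after a
change of origin if necessary. The chain block together with the head and the non-chain block
without it traverse disjoint sets of edges, so one missing edge cannot obstruct both; whichever part
moves, the short spacing grows by one (`Arranged.next_reconstruct`). If `j = k` and robots are left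
over at `v`, two chains leave `v`. Their arcs share just the two edges at `v`, so the rule for the
direction always picks a free way; one robot leaves `v`, the chain in that direction moves ahead of
it, and a new short spacing of length `1` appears (`Arranged.next_spread`). Since `l * k ≤ n`, the
line never closes up around the ring too early.

The invariant `exists_arranged` thus reads `t + k = (a + b) * k + j`. Dispersion holds exactly when
`a + b + 1 = l` and `j = k`, that is, at `t = (l - 1) * k`, and a dispersed placement is a fixed
point (`next_eq_self`).

For the lower bound, the walks are lifted to the integers: after `T` rounds the displacements lie in
`[-T, T]` and are pairwise `k` apart, so `(l - 1) * k ≤ 2 * T` for every algorithm. If `l = n / k ≥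
2`, then `n ≤ 3 * (l - 1) * k`, which makes both bounds linear in `n`. -/

namespace DynRing

/-! ## Integer coordinates on the ring -/

/-- The opposite direction. -/
def Dir.opp : Dir → Dir
  | .cw => .ccw
  | .ccw => .cw

@[simp] theorem Dir.opp_opp (D : Dir) : D.opp.opp = D := by cases D <;> rfl

theorem Dir.eq_or_eq_opp (D E : Dir) : E = D ∨ E = D.opp := by cases D <;> cases E <;> simp [Dir.opp]

/-- The node with coordinate `z` with respect to the origin `v` and the direction `D`. -/
def pt {n : ℕ} (v : ZMod n) (D : Dir) (z : ℤ) : ZMod n := v + (z : ZMod n) * D.step n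

section Ring

variable {n : ℕ}

@[simp] theorem Dir.step_opp (D : Dir) : D.opp.step n = -D.step n := by
  cases D <;> simp [Dir.opp, Dir.step]

theorem walk_eq_pt (v : ZMod n) (D : Dir) (s : ℕ) : walk v D s = pt v D s := by
  simp [walk, pt]

@[simp] theorem pt_zero (v : ZMod n) (D : Dir) : pt v D 0 = v := by simp [pt]

@[simp] theorem walk_zero (v : ZMod n) (D : Dir) : walk v D 0 = v := by simp [walk]

theorem pt_opp (v : ZMod n) (D : Dir) (z : ℤ) : pt v D.opp z = pt v D (-z) := by
  simp [pt]

theorem pt_pt (v : ZMod n) (D : Dir) (z w : ℤ) : pt (pt v D z) D w = pt v D (z + w) := by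
  simp [pt]; ring

theorem pt_sub (v p : ZMod n) (D : Dir) (z : ℤ) : pt (v - p) D z = pt v D z - p := by
  simp [pt]; ring

theorem walk_sub (v p : ZMod n) (D : Dir) (s : ℕ) : walk (v - p) D s = walk v D s - p := by
  simp [walk]; ring

theorem walk_walk (v : ZMod n) (D : Dir) (s t : ℕ) : walk (walk v D s) D t = walk v D (s + t) := by
  simp [walk]; ring

theorem pt_add_step (v : ZMod n) (D : Dir) (z : ℤ) : pt v D z + D.step n = pt v D (z + 1) := by
  simp [pt]; ring

theorem behind_eq_pt (v : ZMod n) (D : Dir) : behind v D = pt v D (-1) := by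
  simp [behind, pt]; ring

theorem walk_behind_succ (v : ZMod n) (D : Dir) (s : ℕ) :
    walk (behind v D) D (s + 1) = walk v D s := by
  simp [walk, behind]; ring

theorem Dir.step_mul_step (D : Dir) : D.step n * D.step n = 1 := by
  cases D <;> simp [Dir.step]

theorem pt_eq_pt_iff_dvd {v : ZMod n} {D : Dir} {z w : ℤ} :
    pt v D z = pt v D w ↔ (n : ℤ) ∣ w - z := by
  rw [← ZMod.intCast_eq_intCast_iff_dvd_sub]
  constructor
  · intro h
    have h' : (z : ZMod n) * D.step n = w * D.step n := by simpa [pt] using h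
    have := congrArg (· * D.step n) h'
    simpa [mul_assoc, Dir.step_mul_step] using this
  · intro h
    simp [pt, h]

theorem pt_eq_pt_iff {v : ZMod n} {D : Dir} {z w : ℤ} (h₁ : z - w < n) (h₂ : w - z < n) :
    pt v D z = pt v D w ↔ z = w := by
  rw [pt_eq_pt_iff_dvd]
  constructor
  · intro h
    have := Int.eq_zero_of_abs_lt_dvd h (by rw [abs_lt]; omega)
    omega
  · rintro rfl
    simp

theorem edgeFrom_sub (x p : ZMod n) (D : Dir) : edgeFrom (x - p) D = edgeFrom x D - p := by
  cases D <;> simp [edgeFrom]; ring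

theorem edgeFrom_injective (D : Dir) : Function.Injective (fun x : ZMod n => edgeFrom x D) := by
  intro x y h
  cases D <;> simpa [edgeFrom] using h

theorem edgeFrom_opp (x : ZMod n) (D : Dir) : edgeFrom x D.opp = edgeFrom (x - D.step n) D := by
  cases D <;> simp [edgeFrom, Dir.opp, Dir.step]

theorem edgeFrom_pt_opp (v : ZMod n) (D : Dir) (z : ℤ) :
    edgeFrom (pt v D z) D.opp = edgeFrom (pt v D (z - 1)) D := by
  rw [edgeFrom_opp]; congr 1; simp [pt]; ring

theorem missingOnArc_sub {m : Option (ZMod n)} {x p : ZMod n} {D : Dir} {c : ℕ} :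
    MissingOnArc (m.map (fun e => e - p)) (x - p) D c ↔ MissingOnArc m x D c := by
  simp only [MissingOnArc, walk_sub, edgeFrom_sub]
  cases m <;> simp

theorem behind_sub (v p : ZMod n) (D : Dir) : behind (v - p) D = behind v D - p := by
  simp [behind]; ring

end Ring

/-! ## One side of a chain -/

section Side

variable {n : ℕ} {occ : ZMod n → Occ} {k : ℕ} {v : ZMod n} {D : Dir} {j a : ℕ}

/-- In direction `D` the node `v` is followed by `a` occupied nodes, the first one `j` hops away
from `v` and the others at spacing `k`, and then by at least `k` null nodes. -/
structure Side (occ : ZMod n → Occ) (k : ℕ) (v : ZMod n) (D : Dir) (j a : ℕ) : Prop where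
  one_le : 1 ≤ j
  le : j ≤ k
  eq_of_zero : a = 0 → j = k
  room : j + k * a < n
  occupied : ∀ s ≤ j + k * a, occ (walk v D s) ≠ .null ↔ s = 0 ∨ ∃ i < a, s = j + k * i

/-- The distance of the last occupied node of a side. -/
def lastOf (k j a : ℕ) : ℕ := j + k * a - k

/-- The convention `j = k` for an empty side makes the truncated subtraction in `lastOf` exact; the
last node is then the origin itself. -/
theorem lastOf_add (h : a = 0 → j = k) : lastOf k j a + k = j + k * a := by
  rcases a with _ | a
  · simp [lastOf, h]
  · simp [lastOf, mul_add]; omega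

theorem lastOf_succ : lastOf k j (a + 1) = j + k * a := by
  simp [lastOf, mul_add]; omega

theorem Side.last_add (h : Side occ k v D j a) : lastOf k j a + k = j + k * a :=
  lastOf_add h.eq_of_zero

theorem Side.le_last (h : Side occ k v D j a) {i : ℕ} (hi : i < a) : j + k * i ≤ lastOf k j a := by
  have := h.last_add
  have : k * (i + 1) ≤ k * a := Nat.mul_le_mul_left _ hi
  rw [mul_add] at this
  omega

theorem Side.occupied_last (h : Side occ k v D j a) : occ (walk v D (lastOf k j a)) ≠ .null := by
  rw [h.occupied _ (by have := h.last_add; omega)]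
  rcases a with _ | a
  · left; simp [lastOf, h.eq_of_zero]
  · right; exact ⟨a, by omega, lastOf_succ⟩

theorem Side.null (h : Side occ k v D j a) {s : ℕ} (h₁ : lastOf k j a < s)
    (h₂ : s ≤ lastOf k j a + k) : occ (walk v D s) = .null := by
  by_contra hc
  rcases (h.occupied s (by have := h.last_add; omega)).1 hc with rfl | ⟨i, hi, rfl⟩
  · omega
  · have := h.le_last hi; omega

theorem Side.null_succ (h : Side occ k v D j a) : occ (walk v D (lastOf k j a + 1)) = .null :=
  h.null (by omega) (by have := h.one_le; have := h.le; omega)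

theorem Side.farFromNext (h : Side occ k v D j a) : FarFromNext occ k (walk v D (lastOf k j a)) D := by
  intro p hp _ ho
  by_contra hk
  rw [walk_walk] at ho
  exact ho (h.null (by omega) (by omega))

theorem Side.last_lt (h : Side occ k v D j a) : lastOf k j a < n := by
  have := h.last_add; have := h.room; have := h.one_le; have := h.le; omega

theorem Side.occupied_first (h : Side occ k v D j a) (ha : a ≠ 0) : occ (walk v D j) ≠ .null := by
  rw [h.occupied _ (by omega)]
  exact Or.inr ⟨0, by omega, by simp⟩

theorem Side.occupied_origin (h : Side occ k v D j a) : occ (walk v D 0) ≠ .null := by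
  rw [h.occupied _ (by omega)]; exact Or.inl rfl

theorem Side.consecutive_first (h : Side occ k v D j a) (ha : a ≠ 0) : Consecutive occ v D 0 j := by
  have := h.one_le
  refine ⟨by omega, h.occupied_origin, h.occupied_first ha, fun r h1 h2 => ?_⟩
  by_contra hc
  rcases (h.occupied r (by omega)).1 hc with rfl | ⟨i, hi, rfl⟩ <;> omega

/-- Consecutive occupied nodes of a side behind its first one are at distance `k`. -/
theorem Side.sub_eq (h : Side occ k v D j a) {s t : ℕ} (hs : s ≠ 0) (ht : t ≤ j + k * a)
    (hc : Consecutive occ v D s t) : t - s = k := by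
  obtain ⟨h1, h2, h3, h4⟩ := hc
  rcases (h.occupied s (by omega)).1 h2 with rfl | ⟨i, hi, rfl⟩
  · omega
  rcases (h.occupied t ht).1 h3 with rfl | ⟨i', hi', rfl⟩
  · omega
  have hlt : i < i' := by
    by_contra hle
    have := Nat.mul_le_mul_left k (not_lt.1 hle)
    omega
  rcases Nat.lt_or_ge (i + 1) i' with hlt' | hge
  · exfalso
    have e : k * (i + 1) = k * i + k := by ring
    have : k * (i + 1) < k * i' := Nat.mul_lt_mul_of_pos_left hlt' (by have := h.one_le; have := h.le; omega)
    have hj := h.one_le; have hk := h.le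
    have := h4 (j + k * (i + 1)) (by omega) (by omega)
    exact (h.occupied (j + k * (i + 1)) (by omega)).2 (Or.inr ⟨i + 1, by omega, rfl⟩) this
  · have e : i' = i + 1 := by omega
    subst e
    rw [mul_add]; omega

theorem Side.sub_eq_of_eq (h : Side occ k v D k a) {s t : ℕ} (ht : t ≤ k + k * a)
    (hc : Consecutive occ v D s t) : t - s = k := by
  rcases Nat.eq_zero_or_pos s with rfl | hs
  · obtain ⟨h1, h2, h3, h4⟩ := hc
    rcases (h.occupied t ht).1 h3 with rfl | ⟨i, hi, rfl⟩
    · omega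
    rcases Nat.eq_zero_or_pos i with rfl | hpos
    · simp
    · exfalso
      have := Nat.mul_le_mul_left k hpos
      have hk := h.one_le
      exact h.occupied_first (by omega) (h4 k (by omega) (by omega))
  · exact h.sub_eq (by omega) ht hc

/-- An arc with a far end whose spacings do not exceed `k` ends with the side. -/
theorem Side.eq_last (h : Side occ k v D j a) {c : ℕ} (hc : c < n) (hocc : occ (walk v D c) ≠ .null)
    (hfar : FarFromNext occ k (walk v D c) D)
    (hsp : ∀ s t, t ≤ c → Consecutive occ v D s t → t - s ≤ k) : c = lastOf k j a := by
  rcases lt_trichotomy c (lastOf k j a) with hlt | heq | hgt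
  · exfalso
    have hl := h.last_add
    have hr := h.room
    -- An arc that stops early sees the next node of the side within `k` hops, against `hfar`.
    have key : ∃ p, 0 < p ∧ p ≤ k ∧ c + p ≤ lastOf k j a ∧ occ (walk v D (c + p)) ≠ .null := by
      rcases (h.occupied c (by omega)).1 hocc with rfl | ⟨i, hi, rfl⟩
      · refine ⟨j, by have := h.one_le; omega, h.le, ?_, ?_⟩
        · rcases a with _ | a
          · rw [h.eq_of_zero rfl] at hlt; simp [lastOf] at hlt
          · have := h.le_last (i := 0) (by omega); simpa using this
        · rcases a with _ | a
          · rw [h.eq_of_zero rfl] at hlt; simp [lastOf] at hlt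
          · simpa using h.occupied_first (by omega)
      · have hne : i + 1 < a := by
          by_contra hge
          have : a = i + 1 := by omega
          subst this
          rw [lastOf_succ] at hlt; omega
        have e : k * (i + 1) = k * i + k := by ring
        refine ⟨k, by have := h.one_le; have := h.le; omega, le_rfl, ?_, ?_⟩
        · have := h.le_last hne; omega
        · have := h.le_last hne
          rw [h.occupied _ (by omega)]
          exact Or.inr ⟨i + 1, hne, by omega⟩
    obtain ⟨p, hp, hpk, hp2, hp3⟩ := key
    have := hfar p hp (by omega) (by rwa [walk_walk])
    omega
  · exact heq
  · exfalso
    classical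
    -- An arc that runs further has to jump over the `k` null nodes behind the side, and the first
    -- occupied node it meets gives a spacing larger than `k`.
    have hex : ∃ t, lastOf k j a < t ∧ occ (walk v D t) ≠ .null := ⟨c, hgt, hocc⟩
    obtain ⟨ht1, ht2⟩ := Nat.find_spec hex
    have hle : Nat.find hex ≤ c := Nat.find_min' hex ⟨hgt, hocc⟩
    have := hsp (lastOf k j a) (Nat.find hex) hle ⟨ht1, h.occupied_last, ht2, fun r h1 h2 => by
      by_contra hc'
      exact Nat.find_min hex h2 ⟨h1, hc'⟩⟩
    exact ht2 (h.null ht1 (by omega))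

/-- A chain or block arc that leaves the origin of a side with a first spacing other than `k`
is not a chain block. -/
theorem Side.not_chainBlock (h : Side occ k v D j a) (hj : j < k) {c : ℕ} :
    ¬ IsChainBlock occ k D v c := by
  rintro ⟨⟨hc, -, ho, -, hf⟩, hsp⟩
  have := h.eq_last hc ho hf fun s t ht hst => (hsp s t (by omega) hst).le
  have ha : a ≠ 0 := fun h0 => by have := h.eq_of_zero h0; omega
  have h1 := hsp 0 j (by have := h.le_last (i := 0) (by omega); simp at this; omega)
    (h.consecutive_first ha)
  omega

theorem Side.chainBlock_iff (h : Side occ k v D k a) (hv : IsBlockHead occ k v) {c : ℕ} :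
    IsChainBlock occ k D v c ↔ c = k * a := by
  have hl : lastOf k k a = k * a := by have := h.last_add; omega
  constructor
  · rintro ⟨⟨hc, -, ho, -, hf⟩, hsp⟩
    rw [h.eq_last hc ho hf fun s t ht hst => (hsp s t (by omega) hst).le, hl]
  · rintro rfl
    have hk := h.one_le
    rw [← hl]
    exact ⟨⟨h.last_lt, hv, h.occupied_last, h.null_succ, h.farFromNext⟩,
      fun s t ht hst => h.sub_eq_of_eq (by omega) hst⟩

theorem Side.nonChainBlock_iff (h : Side occ k v D j a) (hj : j < k) (hv : IsBlockHead occ k v)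
    {c : ℕ} : IsNonChainBlock occ k D v c ↔ c = lastOf k j a := by
  have ha : a ≠ 0 := fun h0 => by have := h.eq_of_zero h0; omega
  constructor
  · rintro ⟨⟨hc, -, ho, -, hf⟩, z, hz, hz0, hzk, hsp⟩
    refine h.eq_last hc ho hf fun s t ht hst => ?_
    rcases Nat.lt_or_ge s z with hsz | hsz
    · rcases Nat.eq_zero_or_pos s with rfl | hs
      · by_contra hlt
        exact hz0.2.2.1 (hst.2.2.2 z hz0.1 (by omega))
      · exact absurd (hz0.2.2.2 s hs hsz) hst.2.1
    · exact (hsp s t hsz (by omega) hst).le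
  · rintro rfl
    have := h.last_add
    have := h.one_le
    refine ⟨⟨h.last_lt, hv, h.occupied_last, h.null_succ, h.farFromNext⟩, j, ?_,
      h.consecutive_first ha, hj, fun s t hs ht hst => h.sub_eq (by omega) (by omega) hst⟩
    have := h.le_last (i := 0) (by omega); simpa using this

theorem Side.not_nonChainBlock (h : Side occ k v D k a) {c : ℕ} : ¬ IsNonChainBlock occ k D v c := by
  rintro ⟨-, z, hz, ⟨hz1, -, hz2, -⟩, hzk, -⟩
  rcases (h.occupied z (by omega)).1 hz2 with rfl | ⟨i, hi, rfl⟩ <;> omega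

theorem Side.not_chain (h : Side occ k v D j a) (hj : j < k) {c : ℕ} : ¬ IsChain occ k D v c := by
  rintro ⟨hc, -, ho, -, hsp, hf⟩
  have hsp' : ∀ s t, t ≤ c + 1 → Consecutive occ v D s t → t - s = k := by
    intro s t ht hst
    -- The arc of a chain starts one node behind `v`, which shifts all indices by one.
    have := hsp (s + 1) (t + 1) (by omega) ⟨by have := hst.1; omega,
      by rw [walk_behind_succ]; exact hst.2.1, by rw [walk_behind_succ]; exact hst.2.2.1, by
        intro r h1 h2
        obtain ⟨r, rfl⟩ : ∃ r', r = r' + 1 := ⟨r - 1, by omega⟩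
        rw [walk_behind_succ]; exact hst.2.2.2 r (by omega) (by omega)⟩
    omega
  have := h.eq_last hc ho hf fun s t ht hst => (hsp' s t (by omega) hst).le
  have ha : a ≠ 0 := fun h0 => by have := h.eq_of_zero h0; omega
  have h1 := hsp' 0 j (by have := h.le_last (i := 0) (by omega); simp at this; omega)
    (h.consecutive_first ha)
  omega

/-- The arc of a chain includes the node behind `v`. If that node is occupied, it creates a spacing
of length `1`, which is admissible only for `k = 1`; this is what `hb` is for. -/
theorem Side.chain_iff (h : Side occ k v D k a) (hv : occ v = .multi)
    (hb : occ (behind v D) ≠ .null → k = 1) {c : ℕ} : IsChain occ k D v c ↔ c = k * a := by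
  have hl : lastOf k k a = k * a := by have := h.last_add; omega
  constructor
  · rintro ⟨hc, -, ho, -, hsp, hf⟩
    rw [← hl]
    refine h.eq_last hc ho hf fun s t ht hst => ?_
    have := hsp (s + 1) (t + 1) (by omega) ⟨by have := hst.1; omega,
      by rw [walk_behind_succ]; exact hst.2.1, by rw [walk_behind_succ]; exact hst.2.2.1, by
        intro r h1 h2
        obtain ⟨r, rfl⟩ : ∃ r', r = r' + 1 := ⟨r - 1, by omega⟩
        rw [walk_behind_succ]; exact hst.2.2.2 r (by omega) (by omega)⟩
    omega
  · rintro rfl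
    have hk := h.one_le
    rw [← hl]
    refine ⟨h.last_lt, hv, h.occupied_last, h.null_succ, fun s t ht hst => ?_, h.farFromNext⟩
    obtain ⟨h1, h2, h3, h4⟩ := hst
    obtain ⟨t, rfl⟩ : ∃ t', t = t' + 1 := ⟨t - 1, by omega⟩
    rcases Nat.eq_zero_or_pos s with rfl | hs
    · rw [walk_zero] at h2
      rcases Nat.eq_zero_or_pos t with rfl | hpos
      · simp [hb h2]
      · have := h4 1 (by omega) (by omega)
        rw [walk_behind_succ, walk_zero, hv] at this
        cases this
    · obtain ⟨s, rfl⟩ : ∃ s', s = s' + 1 := ⟨s - 1, by omega⟩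
      rw [walk_behind_succ] at h2 h3
      have := h.sub_eq_of_eq (s := s) (t := t) (by omega) ⟨by omega, h2, h3, fun r hr1 hr2 => by
        rw [← walk_behind_succ]; exact h4 (r + 1) (by omega) (by omega)⟩
      omega

end Side

/-! ## Coordinates of the occupied nodes -/

/-- The coordinate of the occupied node with index `i`: the nodes with index `≤ 0` are at
spacing `k`, the node with index `1` has coordinate `j`, and from there on the spacing is again `k`. -/
def coord (k j : ℕ) (i : ℤ) : ℤ := if i ≤ 0 then k * i else j + k * (i - 1)

section Coord

variable {k j a b : ℕ} {i i' : ℤ}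

theorem coord_of_le (h : i ≤ 0) : coord k j i = k * i := if_pos h

theorem coord_of_pos (h : 0 < i) : coord k j i = j + k * (i - 1) := if_neg (not_le.2 h)

@[simp] theorem coord_zero : coord k j 0 = 0 := by simp [coord]

theorem coord_self : coord k k i = k * i := by
  unfold coord; split_ifs <;> ring

theorem le_coord (h : -(b : ℤ) ≤ i) : -(k * b : ℤ) ≤ coord k j i := by
  have hk : (0 : ℤ) ≤ k := by positivity
  rcases le_or_gt i 0 with hi | hi
  · rw [coord_of_le hi]
    have := mul_le_mul_of_nonneg_left h hk
    linarith
  · rw [coord_of_pos hi]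
    have h1 := mul_nonneg hk (by omega : 0 ≤ i - 1)
    have h2 : (0 : ℤ) ≤ k * b := by positivity
    omega

theorem coord_add_le (h0 : a = 0 → j = k) (h : i ≤ a) : coord k j i + k ≤ j + k * a := by
  have hk : (0 : ℤ) ≤ k := by positivity
  rcases le_or_gt i 0 with hi | hi
  · rw [coord_of_le hi]
    have h1 := mul_nonneg hk (by omega : 0 ≤ -i)
    rcases a with _ | a
    · rw [h0 rfl]; push_cast; linarith
    · have h2 : (0 : ℤ) ≤ k * a := by positivity
      push_cast
      have : (0 : ℤ) ≤ j := by positivity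
      linarith
  · rw [coord_of_pos hi]
    have := mul_le_mul_of_nonneg_left h hk
    linarith

/-- Only the spacing from index `0` to index `1` can be shorter than `k`. -/
theorem coord_sub_of_lt (hj : j ≤ k) (h : i < i') :
    coord k j i + j ≤ coord k j i' ∧ (i ≠ 0 ∨ i' ≠ 1 → coord k j i + k ≤ coord k j i') := by
  have hk : (0 : ℤ) ≤ k := by positivity
  have hjk : (j : ℤ) ≤ k := by exact_mod_cast hj
  have hj0 : (0 : ℤ) ≤ j := by positivity
  have h1 : (k : ℤ) * (i + 1) ≤ k * i' := mul_le_mul_of_nonneg_left h hk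
  rcases le_or_gt i 0 with hi | hi <;> rcases le_or_gt i' 0 with hi' | hi'
  · rw [coord_of_le hi, coord_of_le hi']
    constructor <;> intros <;> linarith
  · rw [coord_of_le hi, coord_of_pos hi']
    have h2 : (k : ℤ) * i ≤ k * 0 := mul_le_mul_of_nonneg_left hi hk
    have h3 : (k : ℤ) * 1 ≤ k * i' := mul_le_mul_of_nonneg_left hi' hk
    refine ⟨by linarith, fun h => ?_⟩
    rcases h with h | h
    · have h4 : (k : ℤ) * i ≤ k * (-1) := mul_le_mul_of_nonneg_left (by omega) hk
      linarith
    · have h4 : (k : ℤ) * 2 ≤ k * i' := mul_le_mul_of_nonneg_left (by omega) hk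
      linarith
  · omega
  · rw [coord_of_pos hi, coord_of_pos hi']
    constructor <;> intros <;> linarith

end Coord

/-! ## Configurations -/

section Layout

variable {n : ℕ} {occ : ZMod n → Occ} {k : ℕ} {v : ZMod n} {D : Dir} {j a b : ℕ}

/-- The occupied nodes are `v`, `b` nodes behind it with respect to direction `D` and `a` nodes in
direction `D`. Consecutive ones are at distance `k`, but the first one in direction `D` is
`j` hops away from `v`. No node other than `v` is a multiplicity node. -/
structure Layout (occ : ZMod n → Occ) (k : ℕ) (v : ZMod n) (D : Dir) (j a b : ℕ) : Prop where
  one_le : 1 ≤ j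
  le : j ≤ k
  eq_of_zero : a = 0 → j = k
  room : j + k * a + k * b < n
  occupied : ∀ x, occ x ≠ .null ↔ ∃ i : ℤ, -b ≤ i ∧ i ≤ a ∧ x = pt v D (coord k j i)
  multi : ∀ x, occ x = .multi → x = v

theorem Layout.symm (h : Layout occ k v D k a b) : Layout occ k v D.opp k b a where
  one_le := h.one_le
  le := le_rfl
  eq_of_zero _ := rfl
  room := by have := h.room; omega
  occupied x := by
    rw [h.occupied]
    constructor <;> rintro ⟨i, h1, h2, rfl⟩
    · exact ⟨-i, by omega, by omega, by simp [pt_opp, coord_self]⟩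
    · exact ⟨-i, by omega, by omega, by simp [pt_opp, coord_self]⟩
  multi := h.multi

/-- By `room` the nodes behind `v` do not reappear, around the ring, among the first `j + k * a`
nodes ahead of it. -/
theorem Layout.side (h : Layout occ k v D j a b) : Side occ k v D j a where
  one_le := h.one_le
  le := h.le
  eq_of_zero := h.eq_of_zero
  room := by have := h.room; omega
  occupied s hs := by
    have hr := h.room
    have hj := h.one_le
    rw [h.occupied, walk_eq_pt]
    constructor
    · rintro ⟨i, h1, h2, h3⟩
      have b1 := le_coord (k := k) (j := j) h1
      have b2 := coord_add_le h.eq_of_zero h2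
      have hr' : (j + k * a + k * b : ℤ) < n := by exact_mod_cast hr
      have hs' : (s : ℤ) ≤ j + k * a := by exact_mod_cast hs
      have hkb : (0 : ℤ) ≤ k * b := by positivity
      rw [pt_eq_pt_iff (by linarith) (by linarith)] at h3
      rcases lt_trichotomy i 0 with hi | rfl | hi
      · exfalso
        rw [coord_of_le hi.le] at h3
        have := h.le
        have : (k : ℤ) * i < 0 := mul_neg_of_pos_of_neg (by omega) hi
        omega
      · left; simpa using h3
      · right
        rw [coord_of_pos hi] at h3
        refine ⟨(i - 1).toNat, by omega, ?_⟩
        zify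
        rw [Int.toNat_of_nonneg (by omega), h3]
    · rintro (rfl | ⟨i, hi, rfl⟩)
      · exact ⟨0, by omega, by omega, by simp⟩
      · exact ⟨i + 1, by omega, by omega, by rw [coord_of_pos (by omega)]; simp⟩

theorem Layout.side_opp (h : Layout occ k v D j a b) : Side occ k v D.opp k b where
  one_le := h.one_le.trans h.le
  le := le_rfl
  eq_of_zero _ := rfl
  room := by
    have hr := h.room
    rcases a with _ | a
    · have := h.eq_of_zero rfl; omega
    · rw [mul_add] at hr; omega
  occupied s hs := by
    have hr := h.room
    have hj := h.one_le
    rw [h.occupied, walk_eq_pt, pt_opp]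
    constructor
    · rintro ⟨i, h1, h2, h3⟩
      have b1 := le_coord (k := k) (j := j) h1
      have b2 := coord_add_le h.eq_of_zero h2
      have hr' : (j + k * a + k * b : ℤ) < n := by exact_mod_cast hr
      have hs' : (s : ℤ) ≤ k + k * b := by exact_mod_cast hs
      have hk0 : (0 : ℤ) < k := by have := h.le; omega
      have hja : (0 : ℤ) ≤ j + k * a := by positivity
      rw [pt_eq_pt_iff (by linarith) (by linarith)] at h3
      rcases lt_or_ge 0 i with hi | hi
      · exfalso
        have := (coord_sub_of_lt h.le hi).1
        simp at this
        omega
      · rw [coord_of_le hi] at h3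
        rcases hi.lt_or_eq with hi | rfl
        · right
          refine ⟨(-i - 1).toNat, by omega, ?_⟩
          zify
          rw [Int.toNat_of_nonneg (by omega)]
          linarith
        · left; simpa using h3
    · rintro (rfl | ⟨i, hi, rfl⟩)
      · exact ⟨0, by omega, by omega, by simp⟩
      · exact ⟨-(i + 1), by omega, by omega, by
          rw [coord_of_le (by omega)]; congr 1; push_cast; ring⟩

theorem Layout.occupied_origin (h : Layout occ k v D j a b) : occ v ≠ .null :=
  (h.occupied v).2 ⟨0, by omega, by omega, by simp⟩

/-- The indices of occupied nodes determine their coordinates on the ring. -/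
theorem Layout.pt_eq_pt_iff (h : Layout occ k v D j a b) {z w : ℤ} (hz : -(k * b : ℤ) ≤ z)
    (hz' : z + k ≤ j + k * a) (hw : -(k * b : ℤ) ≤ w) (hw' : w + k ≤ j + k * a) :
    pt v D z = pt v D w ↔ z = w := by
  have hr' : (j + k * a + k * b : ℤ) < n := by exact_mod_cast h.room
  have hk0 : (0 : ℤ) ≤ k := by positivity
  exact DynRing.pt_eq_pt_iff (by linarith) (by linarith)

theorem dirDist_pt {z w : ℤ} (h₁ : z ≤ w) (h₂ : w - z < n) :
    dirDist D (pt v D z) (pt v D w) = (w - z).toNat := by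
  have hn : n ≠ 0 := by omega
  have : NeZero n := ⟨hn⟩
  have key : ((w - z : ℤ) : ZMod n).val = (w - z).toNat := by
    rw [← Int.toNat_of_nonneg (by omega : 0 ≤ w - z), Int.cast_natCast, ZMod.val_natCast,
      Nat.mod_eq_of_lt (by omega), Int.toNat_natCast]
  cases D
  · simpa [dirDist, pt, Dir.step] using key
  · rw [← key]; simp only [dirDist, pt, Dir.step]; congr 1; push_cast; ring

/-- Without a multiplicity node the origin of a layout in the clockwise direction is the head. -/
theorem Layout.isHead (h : Layout occ k v .cw j a b) (hj : j < k) (hm : ∀ x, occ x ≠ .multi) :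
    IsHead occ k v := by
  have hr' : (j + k * a + k * b : ℤ) < n := by exact_mod_cast h.room
  have hk0 : (0 : ℤ) ≤ k := by positivity
  have ha : a ≠ 0 := fun h0 => by have := h.eq_of_zero h0; omega
  have hj1 := h.one_le
  have hka : (k : ℤ) * 1 ≤ k * a := mul_le_mul_of_nonneg_left (by omega) hk0
  have hkb : (0 : ℤ) ≤ k * b := by positivity
  have c1 : coord k j 1 = j := by simp [coord]
  have hd : dirDist .cw v (pt v .cw j) = j := by
    have := dirDist_pt (v := v) (D := .cw) (z := 0) (w := j) (n := n) (by omega) (by omega)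
    simpa using this
  refine ⟨hm, pt v .cw j, ⟨?_, h.occupied_origin, ?_, by omega⟩, ?_⟩
  · intro he
    rw [← pt_zero v .cw, pt_pt, DynRing.pt_eq_pt_iff (by omega) (by omega)] at he
    omega
  · exact (h.occupied _).2 ⟨1, by omega, by omega, by rw [c1]⟩
  · intro x y hxy hx hy hlt
    obtain ⟨i, h1, h2, rfl⟩ := (h.occupied x).1 hx
    obtain ⟨i', h1', h2', rfl⟩ := (h.occupied y).1 hy
    have b1 := le_coord (k := k) (j := j) h1
    have b2 := coord_add_le h.eq_of_zero h2
    have b1' := le_coord (k := k) (j := j) h1'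
    have b2' := coord_add_le h.eq_of_zero h2'
    rcases lt_trichotomy i i' with hi | rfl | hi
    · obtain ⟨c2, c3⟩ := coord_sub_of_lt h.le hi
      rw [dirDist_pt (by linarith) (by linarith)] at hlt
      by_cases hc : i ≠ 0 ∨ i' ≠ 1
      · have := c3 hc; omega
      · push Not at hc
        obtain ⟨rfl, rfl⟩ := hc
        simp [c1]
    · exact absurd rfl hxy
    · exfalso
      obtain ⟨c2, -⟩ := coord_sub_of_lt h.le hi
      -- A pair in the reverse order is measured around the ring: adding `n` to the smaller
      -- coordinate gives the clockwise distance, which is at least `k` by `room`.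
      have e : pt v .cw (coord k j i') = pt v .cw (coord k j i' + n) := by simp [pt]
      rw [e, dirDist_pt (by linarith) (by linarith)] at hlt
      have : (k : ℤ) ≤ coord k j i' + n - coord k j i := by linarith
      omega

/-- Heads are defined by clockwise distances, so without a multiplicity node the origin must be the
end from which the short spacing runs clockwise. -/
theorem Layout.isBlockHead_iff (h : Layout occ k v D j a b) (hj : j < k)
    (hv : occ v = .multi ∨ D = .cw ∧ ∀ x, occ x ≠ .multi) {x : ZMod n} :
    IsBlockHead occ k x ↔ x = v := by
  constructor
  · rintro (hx | hx)
    · exact h.multi x hx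
    · rcases hv with hv | ⟨rfl, hm⟩
      · exact absurd hv (hx.1 v)
      · obtain ⟨-, w, ⟨h1, h2, h3, h4⟩, -⟩ := h.isHead hj hm
        obtain ⟨-, w', -, hu⟩ := hx
        exact (hu v w h1 h2 h3 h4).1.symm
  · rintro rfl
    rcases hv with hv | ⟨rfl, hm⟩
    · exact Or.inl hv
    · exact Or.inr (h.isHead hj hm)

theorem Layout.chainBlock_iff (h : Layout occ k v D j a b) (hj : j < k)
    (hv : occ v = .multi ∨ D = .cw ∧ ∀ x, occ x ≠ .multi) {E : Dir} {x : ZMod n} {c : ℕ} :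
    IsChainBlock occ k E x c ↔ E = D.opp ∧ x = v ∧ c = k * b := by
  have hB : IsBlockHead occ k v := (h.isBlockHead_iff hj hv).2 rfl
  constructor
  · intro hc
    obtain rfl := (h.isBlockHead_iff hj hv).1 hc.1.2.1
    rcases D.eq_or_eq_opp E with rfl | rfl
    · exact absurd hc (h.side.not_chainBlock hj)
    · exact ⟨rfl, rfl, (h.side_opp.chainBlock_iff hB).1 hc⟩
  · rintro ⟨rfl, rfl, rfl⟩
    exact (h.side_opp.chainBlock_iff hB).2 rfl

theorem Layout.nonChainBlock_iff (h : Layout occ k v D j a b) (hj : j < k)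
    (hv : occ v = .multi ∨ D = .cw ∧ ∀ x, occ x ≠ .multi) {E : Dir} {x : ZMod n} {c : ℕ} :
    IsNonChainBlock occ k E x c ↔ E = D ∧ x = v ∧ c = lastOf k j a := by
  have hB : IsBlockHead occ k v := (h.isBlockHead_iff hj hv).2 rfl
  constructor
  · intro hc
    obtain rfl := (h.isBlockHead_iff hj hv).1 hc.1.2.1
    rcases D.eq_or_eq_opp E with rfl | rfl
    · exact ⟨rfl, rfl, (h.side.nonChainBlock_iff hj hB).1 hc⟩
    · exact absurd hc h.side_opp.not_nonChainBlock
  · rintro ⟨rfl, rfl, rfl⟩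
    exact (h.side.nonChainBlock_iff hj hB).2 rfl

theorem dirWith_of_iff {P : Dir → Prop} {D : Dir} {q : Prop} [Decidable q]
    (h : ∀ E, P E ↔ E = D ∧ q) : dirWith P = if q then some D else none := by
  unfold dirWith
  cases D <;> simp [h]

/-- A chain configuration needs a chain from `v` in both directions, and the side in direction `D`
starts with the wrong spacing. -/
theorem Layout.not_chainConfig (h : Layout occ k v D j a b) (hj : j < k) :
    ¬ IsChainConfig occ k := by
  rintro ⟨x, c, d, h1, h2⟩
  obtain rfl := h.multi x h1.2.1
  cases D
  · exact h.side.not_chain hj h1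
  · exact h.side.not_chain hj h2

theorem Layout.chain_iff (h : Layout occ k v D k a b) (hv : occ v = .multi) {x : ZMod n} {c : ℕ} :
    IsChain occ k D x c ↔ x = v ∧ c = k * a := by
  have hb : occ (behind v D) ≠ .null → k = 1 := by
    intro ho
    have e : behind v D = walk v D.opp 1 := by rw [behind_eq_pt, walk_eq_pt, pt_opp]; rfl
    have := h.one_le
    rw [e, h.side_opp.occupied _ (by omega)] at ho
    rcases ho with ho | ⟨i, hi, ho⟩
    · omega
    · have : 0 ≤ k * i := by positivity
      omega
  constructor
  · intro hc
    obtain rfl := h.multi x hc.2.1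
    exact ⟨rfl, (h.side.chain_iff hv hb).1 hc⟩
  · rintro ⟨rfl, rfl⟩
    exact (h.side.chain_iff hv hb).2 rfl

theorem Layout.isChainConfig (h : Layout occ k v D k a b) (hv : occ v = .multi) :
    IsChainConfig occ k := by
  cases D
  · exact ⟨v, _, _, (h.chain_iff hv).2 ⟨rfl, rfl⟩, (h.symm.chain_iff hv).2 ⟨rfl, rfl⟩⟩
  · exact ⟨v, _, _, (h.symm.chain_iff hv).2 ⟨rfl, rfl⟩, (h.chain_iff hv).2 ⟨rfl, rfl⟩⟩

end Layout

/-! ## The decisions of the algorithm -/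

section Decisions

variable {n : ℕ} {V : View n} {k : ℕ} {v : ZMod n} {D : Dir} {j a b : ℕ}

open Classical in
/-- The decision in ReconstructChain of the robots on the node with index `i`. -/
theorem Layout.dkd_reconstruct (h : Layout V.occ k v D j a b) (hj : j < k)
    (hv : V.occ v = .multi ∨ D = .cw ∧ ∀ x, V.occ x ≠ .multi) {i : ℤ} (hi : -b ≤ i)
    (hi' : i ≤ a) (h0 : pt v D (coord k j i) = 0) :
    dkdDynamicRing n k V =
      if ¬ MissingOnArc V.missing v D.opp (k * b + 1) then (if i ≤ 0 then some D.opp else none)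
      else (if 0 < i then some D else none) := by
  have hk : 0 < k := by omega
  have hM : MissingInChainBlock V k ↔ MissingOnArc V.missing v D.opp (k * b + 1) := by
    simp [MissingInChainBlock, h.chainBlock_iff hj hv]
  have b1 := le_coord (k := k) (j := j) hi
  have b2 := coord_add_le h.eq_of_zero hi'
  have hka : (k : ℤ) ≤ j + k * a := by
    have := coord_add_le (i := 0) h.eq_of_zero (by omega); simpa using this
  have hkb : (0 : ℤ) ≤ k * b := by positivity
  have hl := h.side.last_add
  have hl' : (lastOf k j a + k : ℤ) = j + k * a := by exact_mod_cast hl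
  have hz : (0 : ZMod n) = v ↔ i = 0 := by
    have e := h.pt_eq_pt_iff (w := 0) b1 b2 (by omega) (by omega)
    rw [pt_zero] at e
    rw [← h0, e]
    rcases lt_trichotomy i 0 with hi | rfl | hi
    · rw [coord_of_le hi.le]; simp; omega
    · simp
    · have := (coord_sub_of_lt h.le hi).1
      have := h.one_le
      rw [coord_zero] at *; omega
  have hneg : ∀ i, i ≤ 0 → coord k j i ≤ 0 := fun i hi => by
    rw [coord_of_le hi]; exact mul_nonpos_of_nonneg_of_nonpos (by positivity) hi
  have hpos : ∀ i, 0 < i → 0 < coord k j i := fun i hi => by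
    have := (coord_sub_of_lt h.le hi).1
    have := h.one_le
    rw [coord_zero] at *; omega
  have hH : ∀ E, OnHeadOfChainBlock V k E ↔ E = D.opp ∧ i = 0 := by
    intro E
    simp [OnHeadOfChainBlock, h.chainBlock_iff hj hv, hz]
  have hC : ∀ E, OnChainBlock V k E ↔ E = D.opp ∧ i ≤ 0 := by
    intro E
    simp only [OnChainBlock, h.chainBlock_iff hj hv]
    constructor
    · rintro ⟨x, c, ⟨rfl, rfl, rfl⟩, s, hs, hs'⟩
      refine ⟨rfl, ?_⟩
      by_contra hi0
      have hs2 : (s : ℤ) ≤ k * b := by exact_mod_cast hs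
      rw [walk_eq_pt, pt_opp, ← h0, h.pt_eq_pt_iff (by omega) (by omega) b1 b2] at hs'
      have := hpos i (by omega)
      omega
    · rintro ⟨rfl, hi0⟩
      have := hneg i hi0
      refine ⟨v, _, ⟨rfl, rfl, rfl⟩, (-coord k j i).toNat, by zify; omega, ?_⟩
      rw [walk_eq_pt, pt_opp, ← h0, Int.toNat_of_nonneg (by omega), neg_neg]
  have hN : ∀ E, OnNonChainBlock V k E ↔ E = D ∧ 0 ≤ i := by
    intro E
    simp only [OnNonChainBlock, h.nonChainBlock_iff hj hv]
    constructor
    · rintro ⟨x, c, ⟨rfl, rfl, rfl⟩, s, hs, hs'⟩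
      refine ⟨rfl, ?_⟩
      by_contra hi0
      rw [walk_eq_pt, ← h0, h.pt_eq_pt_iff (by omega) (by omega) b1 b2,
        coord_of_le (by omega)] at hs'
      have : (k : ℤ) * i < 0 := mul_neg_of_pos_of_neg (by omega) (by omega)
      omega
    · rintro ⟨rfl, hi0⟩
      have : 0 ≤ coord k j i := by
        rcases hi0.eq_or_lt with rfl | hlt
        · simp
        · exact (hpos i hlt).le
      refine ⟨v, _, ⟨rfl, rfl, rfl⟩, (coord k j i).toNat, by zify; omega, ?_⟩
      rw [walk_eq_pt, ← h0, Int.toNat_of_nonneg (by omega)]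
  simp only [dkdDynamicRing, if_neg (h.not_chainConfig hj), reconstructChain,
    h.isBlockHead_iff hj hv, hz, hM, dirWith_of_iff hH, dirWith_of_iff hC, dirWith_of_iff hN]
  split_ifs <;> first | rfl | omega

open Classical in
/-- The direction chosen in Spread in a chain configuration with multiplicity node `v` whose chains
have `c` (clockwise) and `d` (counterclockwise) edges. -/
noncomputable def spreadChoice (missing : Option (ZMod n)) (v : ZMod n) (c d : ℕ) : Dir :=
  if ¬ MissingOnArc missing (behind v .cw) .cw c ∧ ¬ MissingOnArc missing (behind v .ccw) .ccw d
    then .ccw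
  else if ¬ MissingOnArc missing (behind v .cw) .cw c then .cw
  else if ¬ MissingOnArc missing (behind v .ccw) .ccw d then .ccw
  else if missing = some (edgeFrom v .cw) then .ccw
  else .cw

/-- Every robot evaluates the rule in coordinates relative to its own node; invariance under
translation shows that all of them choose the same direction. -/
theorem spreadChoice_sub (m : Option (ZMod n)) (v p : ZMod n) (c d : ℕ) :
    spreadChoice (m.map (fun e => e - p)) (v - p) c d = spreadChoice m v c d := by
  have : m.map (fun e => e - p) = some (edgeFrom (v - p) .cw) ↔ m = some (edgeFrom v .cw) := by
    rw [edgeFrom_sub]; cases m <;> simp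
  have h1 := @missingOnArc_sub n m (behind v .cw) p .cw c
  have h2 := @missingOnArc_sub n m (behind v .ccw) p .ccw d
  rw [← behind_sub] at h1 h2
  unfold spreadChoice
  split_ifs <;> first | rfl | tauto

theorem Layout.badChain_iff (h : Layout V.occ k v D k a b) (hv : V.occ v = .multi) :
    BadChain V k D ↔ MissingOnArc V.missing (behind v D) D (k * a + 2) := by
  simp [BadChain, h.chain_iff hv, and_assoc]

theorem Layout.spreadDir_eq (h : Layout V.occ k v .cw k a b) (hv : V.occ v = .multi) :
    spreadDir V k = spreadChoice V.missing v (k * a + 2) (k * b + 2) := by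
  have h1 := h.badChain_iff hv
  have h2 := Layout.badChain_iff (D := .ccw) h.symm hv
  have h3 : (∃ x, V.occ x = .multi ∧ V.missing = some (edgeFrom x .cw)) ↔
      V.missing = some (edgeFrom v .cw) := by
    constructor
    · rintro ⟨x, hx, hx'⟩
      rwa [h.multi x hx] at hx'
    · exact fun hx => ⟨v, hv, hx⟩
  unfold spreadDir spreadChoice
  split_ifs <;> first | rfl | tauto | exact absurd (h3.1 ‹_›) ‹_› | exact absurd (h3.2 ‹_›) ‹_›

open Classical in
/-- The decision in Spread of the robots on the node with index `i`. -/
theorem Layout.dkd_spread (h : Layout V.occ k v D k a b) (hv : V.occ v = .multi)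
    (hD : spreadDir V k = D) {i : ℤ} (hi : -b ≤ i) (hi' : i ≤ a)
    (h0 : pt v D (coord k k i) = 0) :
    dkdDynamicRing n k V =
      if i = 0 then (if ∀ m ∈ V.here, V.label ≤ m then some D else none)
      else (if 0 < i then some D else none) := by
  have hk : 0 < k := h.one_le
  have b1 := le_coord (k := k) (j := k) hi
  have b2 := coord_add_le h.eq_of_zero hi'
  have hka : (0 : ℤ) ≤ k * a := by positivity
  have hkb : (0 : ℤ) ≤ k * b := by positivity
  rw [coord_self] at h0 b1 b2
  have hz : V.occ 0 = .multi ↔ i = 0 := by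
    have e : (0 : ZMod n) = v ↔ i = 0 := by
      have e := h.pt_eq_pt_iff (w := 0) b1 b2 (by omega) (by omega)
      rw [pt_zero] at e
      rw [← h0, e]
      simp; omega
    rw [← e]
    constructor
    · exact h.multi 0
    · intro e; rw [e]; exact hv
  have hC : OnChain V k D ↔ 0 ≤ i := by
    simp only [OnChain, h.chain_iff hv]
    constructor
    · rintro ⟨x, c, ⟨rfl, rfl⟩, s, hs, hs'⟩
      have hs2 : (s : ℤ) ≤ k * a := by exact_mod_cast hs
      rw [walk_eq_pt, ← h0, h.pt_eq_pt_iff (by omega) (by omega) b1 b2] at hs'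
      by_contra hneg
      have : (k : ℤ) * i < 0 := mul_neg_of_pos_of_neg (by omega) (by omega)
      omega
    · intro hi0
      lift i to ℕ using hi0
      refine ⟨v, _, ⟨rfl, rfl⟩, k * i, Nat.mul_le_mul_left _ (by omega), ?_⟩
      rw [walk_eq_pt, ← h0]; push_cast; rfl
  simp only [dkdDynamicRing, if_pos (h.isChainConfig hv), spread, hz, hD, hC]
  split_ifs <;> first | rfl | omega

/-- The edges that are traversed in Spread are present. -/
theorem spreadChoice_free {m : Option (ZMod n)} {v : ZMod n} {a b : ℕ} (hab : a + b + 1 < n)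
    {s : ℕ} :
    (spreadChoice m v (a + 2) (b + 2) = .cw → s ≤ a → m ≠ some (edgeFrom (walk v .cw s) .cw)) ∧
    (spreadChoice m v (a + 2) (b + 2) = .ccw → s ≤ b → m ≠ some (edgeFrom (walk v .ccw s) .ccw)) := by
  have good : ∀ (D : Dir) (c : ℕ), ¬ MissingOnArc m (behind v D) D (c + 2) → s ≤ c →
      m ≠ some (edgeFrom (walk v D s) D) := fun D c hg hs he =>
    hg ⟨s + 1, by omega, by rw [walk_behind_succ]; exact he⟩
  have e0 : edgeFrom v .cw = edgeFrom (pt v .cw 0) .cw := by simp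
  have e1 : ∀ s : ℕ, edgeFrom (walk v .ccw s) .ccw = edgeFrom (pt v .cw (-s - 1)) .cw := fun s => by
    rw [walk_eq_pt, ← edgeFrom_pt_opp, ← pt_opp]; rfl
  have e2 : ∀ s : ℕ, edgeFrom (walk (behind v .ccw) .ccw s) .ccw = edgeFrom (pt v .cw (-s)) .cw :=
    fun s => by
      rw [behind_eq_pt, walk_eq_pt, pt_pt, show (-s : ℤ) = (1 - s) - 1 by ring,
        ← edgeFrom_pt_opp, show (1 - s : ℤ) = -(-1 + s) by ring, ← pt_opp]; rfl
  have inj : ∀ z w : ℤ, z - w < n → w - z < n →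
      edgeFrom (pt v .cw z) .cw = edgeFrom (pt v .cw w) .cw → z = w := fun z w h1 h2 he =>
    (pt_eq_pt_iff h1 h2).1 (edgeFrom_injective _ he)
  unfold spreadChoice
  split_ifs with h1 h2 h3 h4
  · exact ⟨by simp, fun _ => good .ccw b h1.2⟩
  -- Both chains are bad. With edges numbered clockwise from `v`, the clockwise chain has the edges
  -- `-1, …, a` and the counterclockwise one `-b - 1, …, 0`; these numbers are distinct modulo `n`
  -- by `hab`. Here edge `0` is missing, and the counterclockwise moves use only negative numbers.
  · refine ⟨by simp, fun _ hs he => ?_⟩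
    rw [h4, e0, e1, Option.some_inj] at he
    have := inj _ _ (by omega) (by omega) he
    omega
  -- A missing edge with number `s ≥ 0` that also lies on the counterclockwise chain must be edge
  -- `0`, which `h4` excludes.
  · refine ⟨fun _ hs he => ?_, by simp⟩
    obtain ⟨t, ht, ht'⟩ := h3
    rw [he, walk_eq_pt, e2, Option.some_inj] at ht'
    have := inj _ _ (by omega) (by omega) ht'
    obtain rfl : s = 0 := by omega
    rw [walk_zero] at he
    exact h4 he
  · exact ⟨by simp, fun _ => good .ccw b h3⟩
  · exact ⟨fun _ => good .cw a h2, by simp⟩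

end Decisions

/-! ## Placements of the robots -/

section Occupancy

variable {n l : ℕ} {pos : Placement n l} {x : ZMod n}

theorem occupancy_ne_null_iff : occupancy pos x ≠ .null ↔ ∃ r, pos r = x := by
  unfold occupancy
  split
  · next h =>
    rw [Finset.card_eq_zero, Finset.filter_eq_empty_iff] at h
    simpa using h
  · next h =>
    obtain ⟨r, hr⟩ := Finset.card_pos.1 (h ▸ Nat.one_pos)
    simpa using ⟨r, (Finset.mem_filter.1 hr).2⟩
  · next h =>
    obtain ⟨r, hr⟩ := Finset.card_pos.1 (h ▸ Nat.succ_pos _)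
    simpa using ⟨r, (Finset.mem_filter.1 hr).2⟩

theorem occupancy_eq_multi_iff :
    occupancy pos x = .multi ↔ ∃ r r', r ≠ r' ∧ pos r = x ∧ pos r' = x := by
  have key : (∃ r r', r ≠ r' ∧ pos r = x ∧ pos r' = x) ↔
      1 < (Finset.univ.filter (fun r => pos r = x)).card := by
    rw [Finset.one_lt_card]
    simp only [Finset.mem_filter, Finset.mem_univ, true_and]
    constructor
    · rintro ⟨r, r', h, h1, h2⟩
      exact ⟨r, h1, r', h2, h⟩
    · rintro ⟨r, h1, r', h2, h⟩
      exact ⟨r, r', h, h1, h2⟩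
  rw [key]
  unfold occupancy
  split <;> simp_all

end Occupancy

/-- The snapshot of a robot on `p` is the configuration translated by `-p`, so global layouts can be
used inside views. -/
theorem Layout.shift {n : ℕ} {occ : ZMod n → Occ} {k : ℕ} {v : ZMod n} {D : Dir} {j a b : ℕ}
    (h : Layout occ k v D j a b) (p : ZMod n) :
    Layout (fun u => occ (p + u)) k (v - p) D j a b where
  one_le := h.one_le
  le := h.le
  eq_of_zero := h.eq_of_zero
  room := h.room
  occupied x := by
    rw [h.occupied]
    simp only [pt_sub, eq_sub_iff_add_eq']
  multi x hx := by rw [eq_sub_iff_add_eq']; exact h.multi _ hx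

section Arranged

variable {n k l : ℕ} {pos : Placement n l} {g : Fin l → ℤ} {v : ZMod n} {D : Dir} {j a b : ℕ}

/-- The robots are placed on the nodes with coordinates `coord k j i` for `-b ≤ i ≤ a`; robot `r`
is on the one with index `g r`, and only the one with index `0` may hold several robots. -/
structure Arranged (k : ℕ) (pos : Placement n l) (g : Fin l → ℤ) (v : ZMod n) (D : Dir)
    (j a b : ℕ) : Prop where
  one_le : 1 ≤ j
  le : j ≤ k
  eq_of_zero : a = 0 → j = k
  mem : ∀ r, -b ≤ g r ∧ g r ≤ a
  surj : ∀ i : ℤ, -b ≤ i → i ≤ a → ∃ r, g r = i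
  inj : ∀ r r', g r = g r' → g r ≠ 0 → r = r'
  pos_eq : ∀ r, pos r = pt v D (coord k j (g r))

theorem Arranged.image (h : Arranged k pos g v D j a b) :
    Finset.univ.image g = Finset.Icc (-b : ℤ) a := by
  ext i
  simp only [Finset.mem_image, Finset.mem_univ, true_and, Finset.mem_Icc]
  constructor
  · rintro ⟨r, rfl⟩; exact h.mem r
  · rintro ⟨h1, h2⟩; exact h.surj i h1 h2

theorem Arranged.card_image (h : Arranged k pos g v D j a b) :
    (Finset.univ.image g).card = a + b + 1 := by
  rw [h.image, Int.card_Icc]; omega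

theorem Arranged.card_le (h : Arranged k pos g v D j a b) : a + b + 1 ≤ l := by
  have := Finset.card_image_le (s := Finset.univ) (f := g)
  rwa [h.card_image, Finset.card_univ, Fintype.card_fin] at this

theorem Arranged.injective_iff (h : Arranged k pos g v D j a b) :
    Function.Injective g ↔ a + b + 1 = l := by
  have := Finset.card_image_iff (s := Finset.univ) (f := g)
  rw [h.card_image, Finset.card_univ, Fintype.card_fin, Finset.coe_univ,
    Set.injOn_univ] at this
  exact this.symm

/-- The slack `k` covers the final case `l * k = n`, `j = k`, in which the line closes up around the
ring and `Arranged.room` fails. -/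
theorem Arranged.span_lt (h : Arranged k pos g v D j a b) (hl : l * k ≤ n) :
    j + k * a + k * b < n + k := by
  have h1 := Nat.mul_le_mul_right k h.card_le
  have := h.one_le
  have := h.le
  have e : (a + b + 1) * k = k * a + k * b + k := by ring
  omega

theorem Arranged.room (h : Arranged k pos g v D j a b) (hl : l * k ≤ n)
    (hf : j < k ∨ a + b + 1 < l) : j + k * a + k * b < n := by
  have := h.one_le
  have := h.le
  have e : (a + b + 1) * k = k * a + k * b + k := by ring
  rcases hf with hf | hf
  · have h1 := Nat.mul_le_mul_right k h.card_le
    omega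
  · have h1 := Nat.mul_le_mul_right k hf
    have e' : (a + b + 1 + 1) * k = k * a + k * b + k + k := by ring
    rw [Nat.succ_eq_add_one] at h1
    omega

theorem Arranged.pos_eq_pos_iff (h : Arranged k pos g v D j a b) (hl : l * k ≤ n) {r r' : Fin l} :
    pos r = pos r' ↔ g r = g r' := by
  have hs : (j + k * a + k * b : ℤ) < n + k := by exact_mod_cast h.span_lt hl
  have a1 := le_coord (k := k) (j := j) (h.mem r).1
  have a2 := coord_add_le h.eq_of_zero (h.mem r).2
  have b1 := le_coord (k := k) (j := j) (h.mem r').1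
  have b2 := coord_add_le h.eq_of_zero (h.mem r').2
  rw [h.pos_eq, h.pos_eq, pt_eq_pt_iff (by linarith) (by linarith)]
  constructor
  · intro he
    have := h.one_le
    rcases lt_trichotomy (g r) (g r') with hlt | heq | hlt
    · have := (coord_sub_of_lt h.le hlt).1; omega
    · exact heq
    · have := (coord_sub_of_lt h.le hlt).1; omega
  · intro he; rw [he]

theorem Arranged.layout (h : Arranged k pos g v D j a b) (hl : l * k ≤ n)
    (hf : j < k ∨ a + b + 1 < l) : Layout (occupancy pos) k v D j a b where
  one_le := h.one_le
  le := h.le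
  eq_of_zero := h.eq_of_zero
  room := h.room hl hf
  occupied x := by
    rw [occupancy_ne_null_iff]
    constructor
    · rintro ⟨r, rfl⟩
      exact ⟨g r, (h.mem r).1, (h.mem r).2, h.pos_eq r⟩
    · rintro ⟨i, h1, h2, rfl⟩
      obtain ⟨r, rfl⟩ := h.surj i h1 h2
      exact ⟨r, h.pos_eq r⟩
  multi x hx := by
    obtain ⟨r, r', hne, rfl, hr⟩ := occupancy_eq_multi_iff.1 hx
    have he := (h.pos_eq_pos_iff hl).1 hr.symm
    have : g r = 0 := by
      by_contra h0
      exact hne (h.inj r r' he h0)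
    rw [h.pos_eq, this]; simp

theorem Arranged.multi_iff (h : Arranged k pos g v D j a b) (hl : l * k ≤ n) :
    (∃ x, occupancy pos x = .multi) ↔ a + b + 1 < l := by
  rw [lt_iff_le_and_ne, and_iff_right h.card_le, ne_eq, ← h.injective_iff]
  simp only [occupancy_eq_multi_iff, Function.Injective, not_forall]
  constructor
  · rintro ⟨x, r, r', hne, rfl, he⟩
    exact ⟨r, r', (h.pos_eq_pos_iff hl).1 he.symm, hne⟩
  · rintro ⟨r, r', he, hne⟩
    exact ⟨_, r, r', hne, rfl, (h.pos_eq_pos_iff hl).2 he.symm⟩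

theorem Arranged.multi (h : Arranged k pos g v D j a b) (hl : l * k ≤ n) (hm : a + b + 1 < l) :
    occupancy pos v = .multi := by
  obtain ⟨x, hx⟩ := (h.multi_iff hl).2 hm
  rwa [(h.layout hl (Or.inr hm)).multi x hx] at hx

theorem Arranged.symm (h : Arranged k pos g v D k a b) :
    Arranged k pos (fun r => -g r) v D.opp k b a where
  one_le := h.one_le
  le := le_rfl
  eq_of_zero _ := rfl
  mem r := by have := h.mem r; omega
  surj i h1 h2 := by
    obtain ⟨r, hr⟩ := h.surj (-i) (by omega) (by omega)
    exact ⟨r, by omega⟩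
  inj r r' h1 h2 := h.inj r r' (by simpa using h1) (by simpa using h2)
  pos_eq r := by rw [h.pos_eq, pt_opp, coord_self, coord_self]; congr 1; ring

/-- Without multiplicity node either end of the short spacing may serve as the origin. -/
theorem Arranged.rebase (h : Arranged k pos g v D j (a + 1) b) (hg : Function.Injective g) :
    Arranged k pos (fun r => 1 - g r) (pt v D j) D.opp j (b + 1) a where
  one_le := h.one_le
  le := h.le
  eq_of_zero h0 := by omega
  mem r := by have := h.mem r; omega
  surj i h1 h2 := by
    obtain ⟨r, hr⟩ := h.surj (1 - i) (by omega) (by omega)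
    exact ⟨r, by omega⟩
  inj r r' h1 _ := hg (by simpa using h1)
  pos_eq r := by
    rw [h.pos_eq, pt_opp, pt_pt]
    congr 1
    rcases le_or_gt (g r) 0 with hr | hr
    · rw [coord_of_le hr, coord_of_pos (by omega)]; ring
    · rw [coord_of_pos hr, coord_of_le (by omega)]; ring

/-- In ReconstructChain one may assume that the origin is the block head. -/
theorem Arranged.exists_head (h : Arranged k pos g v D j a b) (hj : j < k) :
    ∃ g' v' D' a' b', Arranged k pos g' v' D' j a' b' ∧ a' + b' = a + b ∧
      (a' + b' + 1 < l ∨ D' = .cw ∧ a' + b' + 1 = l) := by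
  rcases h.card_le.lt_or_eq with hlt | heq
  · exact ⟨g, v, D, a, b, h, rfl, Or.inl hlt⟩
  -- Without a multiplicity node a short spacing that runs counterclockwise is read from its other
  -- end.
  · cases D
    · exact ⟨g, v, _, a, b, h, rfl, Or.inr ⟨rfl, heq⟩⟩
    · obtain ⟨a, rfl⟩ : ∃ c, a = c + 1 :=
        ⟨a - 1, by have := h.eq_of_zero; omega⟩
      exact ⟨_, _, _, _, _, h.rebase (h.injective_iff.2 heq), by omega, Or.inr ⟨rfl, by omega⟩⟩

/-! ## One round -/

/-- The placement after one round of the algorithm. -/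
noncomputable def next (k : ℕ) (label : Fin l → ℕ) (m : Option (ZMod n)) (pos : Placement n l) :
    Placement n l :=
  fun r => moveRobot (pos r) m (dkdDynamicRing n k (look label pos m r))

variable {label : Fin l → ℕ} {m : Option (ZMod n)}

theorem look_pt_eq_zero (h : Arranged k pos g v D j a b) (r : Fin l) :
    pt (v - pos r) D (coord k j (g r)) = 0 := by
  rw [pt_sub, ← h.pos_eq, sub_self]

theorem moveRobot_pt {z : ℤ} (h : m ≠ some (edgeFrom (pt v D z) D)) :
    moveRobot (pt v D z) m (some D) = pt v D (z + 1) := by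
  simp [moveRobot, h, pt_add_step]

theorem moveRobot_pt_opp {z : ℤ} (h : m ≠ some (edgeFrom (pt v D z) D.opp)) :
    moveRobot (pt v D z) m (some D.opp) = pt v D (z - 1) := by
  simp [moveRobot, h]
  simp [pt]; ring

/-- Either the indices `≤ 0` step back, taking the origin along, or the indices `> 0` step forward.
The index of each robot is unchanged and the spacing between indices `0` and `1` grows by one. -/
theorem Arranged.next_reconstruct (h : Arranged k pos g v D j a b) (hl : l * k ≤ n) (hj : j < k)
    (hv : a + b + 1 < l ∨ D = .cw ∧ a + b + 1 = l) :
    ∃ v', Arranged k (next k label m pos) g v' D (j + 1) a b := by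
  classical
  have L := h.layout hl (Or.inl hj)
  have hv' : occupancy pos v = .multi ∨ D = .cw ∧ ∀ x, occupancy pos x ≠ .multi := by
    refine hv.imp (h.multi hl) (And.imp_right fun he => ?_)
    have := (not_congr (h.multi_iff hl)).2 (by omega)
    simpa using this
  have dec : ∀ r, dkdDynamicRing n k (look label pos m r) =
      if ¬ MissingOnArc m v D.opp (k * b + 1) then (if g r ≤ 0 then some D.opp else none)
      else (if 0 < g r then some D else none) := by
    intro r
    have L' : Layout (look label pos m r).occ k (v - pos r) D j a b := L.shift (pos r)
    rw [L'.dkd_reconstruct hj ?_ (h.mem r).1 (h.mem r).2 (look_pt_eq_zero h r)]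
    · have : MissingOnArc (look label pos m r).missing (v - pos r) D.opp (k * b + 1) ↔
          MissingOnArc m v D.opp (k * b + 1) := missingOnArc_sub
      split_ifs <;> first | rfl | tauto
    · refine hv'.imp (fun h1 => ?_) (And.imp_right fun h1 x => h1 _)
      change occupancy pos (pos r + (v - pos r)) = _
      rwa [add_sub_cancel]
  have ha : a ≠ 0 := fun h0 => by have := h.eq_of_zero h0; omega
  by_cases hm : MissingOnArc m v D.opp (k * b + 1)
  · refine ⟨v, by omega, by omega, fun h0 => absurd h0 ha, h.mem, h.surj, h.inj, fun r => ?_⟩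
    unfold next
    rw [dec, if_neg (not_not.2 hm)]
    split_ifs with hr
    · rw [h.pos_eq, moveRobot_pt, coord_of_pos hr, coord_of_pos hr]
      · congr 1; push_cast; ring
      -- The missing edge has coordinate between `-(k * b) - 1` and `-1`, the edges to be traversed
      -- have positive coordinates, and `room` excludes coincidences modulo `n`.
      · obtain ⟨s, hs, rfl⟩ := hm
        intro he
        rw [Option.some_inj, walk_eq_pt, pt_opp, edgeFrom_pt_opp] at he
        have hr' : (j + k * a + k * b : ℤ) < n := by exact_mod_cast L.room
        have hs' : (s : ℤ) < k * b + 1 := by exact_mod_cast hs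
        have b2 := coord_add_le h.eq_of_zero (h.mem r).2
        have b3 := (coord_sub_of_lt h.le hr).1
        have := h.one_le
        rw [coord_zero] at b3
        have := (pt_eq_pt_iff (by omega) (by omega)).1 (edgeFrom_injective _ he)
        omega
    · rw [h.pos_eq, coord_of_le (by omega), coord_of_le (by omega)]; rfl
  · refine ⟨pt v D (-1), by omega, by omega, fun h0 => absurd h0 ha, h.mem, h.surj, h.inj,
      fun r => ?_⟩
    unfold next
    rw [dec, if_pos hm]
    split_ifs with hr
    · rw [h.pos_eq, moveRobot_pt_opp, coord_of_le hr, coord_of_le hr, pt_pt]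
      · congr 1; ring
      · intro he
        apply hm
        have b1 := le_coord (k := k) (j := j) (h.mem r).1
        have b3 : coord k j (g r) ≤ 0 := by
          rw [coord_of_le hr]
          exact mul_nonpos_of_nonneg_of_nonpos (by positivity) hr
        -- The edge crossed from coordinate `-s` has position `s` on the arc of the chain block; the
        -- outermost robot, `s = k * b`, accounts for its last edge.
        refine ⟨(-coord k j (g r)).toNat, by zify; omega, ?_⟩
        rw [he, walk_eq_pt, Int.toNat_of_nonneg (by omega), pt_opp, neg_neg]
    · rw [h.pos_eq, coord_of_pos (by omega), coord_of_pos (by omega), pt_pt]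
      simp only [moveRobot]
      congr 1; push_cast; ring

/-- The least labelled robot on `v` becomes the new index `1` and each robot ahead moves up one
index: coordinate `k * i + 1` is index `i + 1` for `j = 1`. -/
theorem Arranged.next_spread_of_dir (h : Arranged k pos g v D k a b) (hl : l * k ≤ n)
    (hlab : Function.Injective label) (hm : a + b + 1 < l)
    (hD : ∀ r, spreadDir (look label pos m r) k = D)
    (hfree : ∀ s ≤ k * a, m ≠ some (edgeFrom (walk v D s) D)) :
    ∃ g', Arranged k (next k label m pos) g' v D 1 (a + 1) b := by
  classical
  have L := h.layout hl (Or.inr hm)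
  have hk : 0 < k := h.one_le
  obtain ⟨r₀, hr₀, hmin⟩ := Finset.exists_min_image (Finset.univ.filter fun r => g r = 0) label
    (by obtain ⟨r, hr⟩ := h.surj 0 (by omega) (by omega)
        exact ⟨r, by simpa using hr⟩)
  simp only [Finset.mem_filter, Finset.mem_univ, true_and] at hr₀ hmin
  have dec : ∀ r, dkdDynamicRing n k (look label pos m r) =
      if r = r₀ ∨ 0 < g r then some D else none := by
    intro r
    have L' : Layout (look label pos m r).occ k (v - pos r) D k a b := L.shift (pos r)
    rw [L'.dkd_spread ?_ (hD r) (h.mem r).1 (h.mem r).2 (look_pt_eq_zero h r)]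
    · have hlow : g r = 0 → ((∀ q ∈ (look label pos m r).here, (look label pos m r).label ≤ q) ↔
          r = r₀) := by
        intro hr
        have : (∀ q ∈ (look label pos m r).here, (look label pos m r).label ≤ q) ↔
            ∀ r', pos r' = pos r → label r ≤ label r' := by
          simp [look]
        rw [this]
        constructor
        · intro hle
          exact hlab (le_antisymm (hle r₀ ((h.pos_eq_pos_iff hl).2 (hr₀.trans hr.symm)))
            (hmin r hr))
        · rintro rfl r' hr'
          exact hmin r' (((h.pos_eq_pos_iff hl).1 hr').trans hr)
      by_cases h0 : g r = 0
      · rw [if_pos h0]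
        simp only [hlow h0, h0, lt_irrefl, or_false]
      · have : r ≠ r₀ := by rintro rfl; exact h0 hr₀
        simp [h0, this]
    · change occupancy pos (pos r + (v - pos r)) = _
      rw [add_sub_cancel]
      exact h.multi hl hm
  -- There are more robots than occupied nodes, so `v` stays occupied and index `0` is still
  -- attained.
  have hmult : ∃ r₁, r₁ ≠ r₀ ∧ g r₁ = 0 := by
    by_contra! hc
    have : Function.Injective g := by
      intro r r' he
      by_cases h0 : g r = 0
      · have h1 : r = r₀ := by by_contra hne; exact hc r hne h0
        have h2 : r' = r₀ := by by_contra hne; exact hc r' hne (he ▸ h0)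
        rw [h1, h2]
      · exact h.inj r r' he h0
    have := h.injective_iff.1 this
    omega
  refine ⟨fun r => if r = r₀ ∨ 0 < g r then g r + 1 else g r, le_rfl, hk, by omega, ?_, ?_, ?_, ?_⟩
  · intro r
    have := h.mem r
    split_ifs <;> push_cast <;> omega
  · intro i h1 h2
    rcases lt_trichotomy i 0 with hi | rfl | hi
    · obtain ⟨r, hr⟩ := h.surj i h1 (by omega)
      refine ⟨r, ?_⟩
      have : r ≠ r₀ := by rintro rfl; omega
      rw [if_neg (by omega), hr]
    · obtain ⟨r₁, hne, hr⟩ := hmult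
      refine ⟨r₁, ?_⟩
      rw [if_neg (by omega), hr]
    · rcases (show i = 1 ∨ 1 < i by omega) with rfl | hi
      · exact ⟨r₀, by simp [hr₀]⟩
      · obtain ⟨r, hr⟩ := h.surj (i - 1) (by omega) (by push_cast at h2; omega)
        refine ⟨r, ?_⟩
        rw [if_pos (by omega), hr]; ring
  · intro r r' he hne
    by_cases hr : r = r₀
    · by_cases hr' : r' = r₀
      · rw [hr, hr']
      · exfalso
        simp only [hr, hr', true_or, if_true, false_or, hr₀] at he
        split_ifs at he <;> omega
    · by_cases hr' : r' = r₀
      · exfalso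
        simp only [hr, hr', true_or, if_true, false_or, hr₀] at he
        split_ifs at he <;> omega
      · simp only [hr, hr', false_or] at he hne
        apply h.inj r r' <;> split_ifs at he hne <;> omega
  · intro r
    unfold next
    rw [dec]
    have b1 := (h.mem r).2
    split_ifs with hr
    · have h0 : 0 ≤ g r := by
        rcases hr with rfl | hr
        · exact hr₀.ge
        · exact hr.le
      rw [h.pos_eq, coord_self, moveRobot_pt, coord_of_pos (by omega)]
      · congr 1; push_cast; ring
      · obtain ⟨i, hi⟩ := Int.eq_ofNat_of_zero_le h0
        have := hfree (k * i) (Nat.mul_le_mul_left k (by omega))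
        rw [walk_eq_pt] at this
        rw [hi]
        simpa using this
    · rw [h.pos_eq, coord_self, coord_of_le (by omega)]; rfl

theorem Arranged.next_spread (h : Arranged k pos g v D k a b) (hl : l * k ≤ n)
    (hlab : Function.Injective label) (hm : a + b + 1 < l) :
    ∃ g' v' D' a' b', Arranged k (next k label m pos) g' v' D' 1 a' b' ∧ a' + b' = a + b + 1 := by
  -- With all spacings equal to `k` the arrangement can be reflected, while the rule for the
  -- direction is stated clockwise first.
  wlog hD : D = .cw generalizing D g a b with H
  · have : D.opp = .cw := by cases D <;> simp_all [Dir.opp]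
    obtain ⟨g', v', D', a', b', h1, h2⟩ := H h.symm (by omega) this
    exact ⟨g', v', D', a', b', h1, by omega⟩
  subst hD
  have L := h.layout hl (Or.inr hm)
  have hr := L.room
  have hk := h.one_le
  have dir : ∀ r, spreadDir (look label pos m r) k =
      spreadChoice m v (k * a + 2) (k * b + 2) := by
    intro r
    have L' : Layout (look label pos m r).occ k (v - pos r) .cw k a b := L.shift (pos r)
    rw [L'.spreadDir_eq, ← spreadChoice_sub m v (pos r)]
    · rfl
    · change occupancy pos (pos r + (v - pos r)) = _
      rw [add_sub_cancel]
      exact h.multi hl hm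
  have free := fun s => spreadChoice_free (m := m) (v := v) (a := k * a) (b := k * b) (s := s)
    (by
      have e : (a + b + 1 + 1) * k = k * a + k * b + k + k := by ring
      have := Nat.mul_le_mul_right k hm
      rw [Nat.succ_eq_add_one] at this
      omega)
  cases hc : spreadChoice m v (k * a + 2) (k * b + 2)
  · obtain ⟨g', hg'⟩ := h.next_spread_of_dir hl hlab hm (fun r => (dir r).trans hc)
      fun s hs => (free s).1 hc hs
    exact ⟨g', v, _, _, _, hg', by omega⟩
  · obtain ⟨g', hg'⟩ := Arranged.next_spread_of_dir (D := .ccw) h.symm hl hlab (by omega)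
      (fun r => (dir r).trans hc) fun s hs => (free s).2 hc hs
    exact ⟨g', v, _, _, _, hg', by omega⟩

/-! ## Dispersion -/

theorem ringDist_pt {z w : ℤ} (h₁ : z < w) (h₂ : w - z < n) :
    ringDist (pt v D z) (pt v D w) = min (w - z).toNat (n - (w - z)).toNat := by
  have e1 := dirDist_pt (v := v) (D := D) (z := z) (w := w) (n := n) h₁.le h₂
  -- The way back from `w` ends at the lift `z + n` of the first node.
  have e2 := dirDist_pt (v := v) (D := D) (z := w) (w := z + n) (n := n) (by omega) (by omega)
  have e : pt v D (z + n) = pt v D z := by simp [pt]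
  rw [e, show (z + n - w : ℤ) = n - (w - z) by ring] at e2
  have e3 : ringDist (pt v D z) (pt v D w) =
      min (dirDist D (pt v D z) (pt v D w)) (dirDist D (pt v D w) (pt v D z)) := by
    cases D
    · rfl
    · rw [min_comm]; rfl
  rw [e3, e1, e2]

theorem ringDist_comm (x y : ZMod n) : ringDist x y = ringDist y x := by
  unfold ringDist dirDist; rw [min_comm]

/-- Leftover robots share the node `v`; otherwise the robots with indices `0` and `1` are only `j <
k` apart. -/
theorem Arranged.not_dispersed (h : Arranged k pos g v D j a b) (hl : l * k ≤ n)
    (hf : j < k ∨ a + b + 1 < l) : ¬ IsDistanceDispersed k pos := by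
  rintro ⟨hinj, hdist, -⟩
  have hg : Function.Injective g := fun r r' he => hinj ((h.pos_eq_pos_iff hl).2 he)
  have hj : j < k := hf.resolve_right (by have := h.injective_iff.1 hg; omega)
  have ha : a ≠ 0 := fun h0 => by have := h.eq_of_zero h0; omega
  obtain ⟨r, hr⟩ := h.surj 0 (by omega) (by omega)
  obtain ⟨r', hr'⟩ := h.surj 1 (by omega) (by omega)
  have h1 := hdist r r' (by rintro rfl; omega)
  have hroom := h.room hl (Or.inl hj)
  have := h.one_le
  have hka := Nat.mul_le_mul_left k (Nat.one_le_iff_ne_zero.2 ha)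
  rw [h.pos_eq, h.pos_eq, hr, hr', show coord k j 1 = j by simp [coord], coord_zero,
    ringDist_pt (by omega) (by omega)] at h1
  omega

theorem Arranged.dispersed (h : Arranged k pos g v D k a b) (hl : l * k ≤ n) (h2 : 2 ≤ l)
    (hf : a + b + 1 = l) : IsDistanceDispersed k pos := by
  have hg := h.injective_iff.2 hf
  have hk := h.one_le
  -- This leaves at least `k` hops between the two ends of the line on the other way around the
  -- ring.
  have hspan : (k * a + k * b + k : ℤ) ≤ n := by
    have e : (a + b + 1) * k = k * a + k * b + k := by ring
    rw [← hf, e] at hl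
    exact_mod_cast hl
  have key : ∀ r r', g r < g r' → ringDist (pos r) (pos r') =
      min (k * (g r' - g r)).toNat (n - k * (g r' - g r)).toNat ∧
      k ≤ ringDist (pos r) (pos r') := by
    intro r r' hlt
    have a1 := le_coord (k := k) (j := k) (h.mem r).1
    have b2 := coord_add_le h.eq_of_zero (h.mem r').2
    have hlt' := (coord_sub_of_lt (k := k) (j := k) le_rfl hlt).1
    rw [coord_self] at a1 b2 hlt'
    rw [coord_self] at hlt'
    rw [h.pos_eq, h.pos_eq, coord_self, coord_self, ringDist_pt (by omega) (by omega), mul_sub]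
    refine ⟨rfl, ?_⟩
    rw [le_min_iff]
    constructor <;> omega
  refine ⟨fun r r' he => hg ((h.pos_eq_pos_iff hl).1 he), fun r r' hne => ?_, ?_⟩
  · rcases lt_or_gt_of_ne (hg.ne hne) with hlt | hlt
    · exact (key r r' hlt).2
    · rw [ringDist_comm]; exact (key r' r hlt).2
  · obtain ⟨r, hr⟩ := h.surj (-b) le_rfl (by omega)
    obtain ⟨r', hr'⟩ := h.surj (-b + 1) (by omega) (by omega)
    refine ⟨r, r', by rintro rfl; omega, ?_⟩
    obtain ⟨h3, h4⟩ := key r r' (by omega)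
    rw [hr, hr', show (k : ℤ) * (-b + 1 - -b) = k by ring] at h3
    rw [h3] at h4 ⊢
    omega

theorem reconstructChain_eq_none {V : View n} (h : ∀ x, ¬ IsBlockHead V.occ k x) :
    reconstructChain k V = none := by
  have h1 : ∀ D x c, ¬ IsChainBlock V.occ k D x c := fun D x c hc => h x hc.1.2.1
  simp [reconstructChain, h, MissingInChainBlock, dirWith, OnChainBlock, h1]

/-- In a dispersed configuration no robot moves. -/
theorem next_eq_self (hd : IsDistanceDispersed k pos) : next k label m pos = pos := by
  funext r
  have hm : ∀ x, (look label pos m r).occ x ≠ .multi := by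
    intro x hx
    obtain ⟨r₁, r₂, hne, h1, h2⟩ := occupancy_eq_multi_iff.1 hx
    exact hne (hd.1 (h1.trans h2.symm))
  have hb : ∀ x, ¬ IsBlockHead (look label pos m r).occ k x := by
    rintro x (hx | ⟨-, y, ⟨hxy, hx, hy, hlt⟩, -⟩)
    · exact hm x hx
    · obtain ⟨r₁, h1⟩ := occupancy_ne_null_iff.1 hx
      obtain ⟨r₂, h2⟩ := occupancy_ne_null_iff.1 hy
      have := hd.2.1 r₁ r₂ (by rintro rfl; exact hxy (add_left_cancel (h1.symm.trans h2)))
      rw [h1, h2] at this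
      have h3 := this.trans (min_le_left _ _)
      simp only [dirDist, add_sub_add_left_eq_sub] at h3 hlt
      omega
  have hc : ¬ IsChainConfig (look label pos m r).occ k := by
    rintro ⟨x, c, d, h1, -⟩
    exact hm x h1.2.1
  unfold next
  rw [dkdDynamicRing, if_neg hc, reconstructChain_eq_none hb]
  rfl

end Arranged

/-! ## The execution of the algorithm -/

section Execution

variable {n k l : ℕ} {label : Fin l → ℕ} {root : ZMod n} {G : DynamicRing n}

theorem execution_succ (t : ℕ) :
    execution (dkdDynamicRing n k) label root G (t + 1) =
      next k label (G t) (execution (dkdDynamicRing n k) label root G t) := rfl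

/-- The quantity `(a + b) * k + j` is a clock: reconstruction replaces `j` by `j + 1`, and spreading
replaces `j = k` by `1` while `a + b` grows by one. -/
theorem exists_arranged (hk : 1 ≤ k) (h2 : 2 ≤ l) (hl : l * k ≤ n)
    (hlab : Function.Injective label) {t : ℕ} (ht : t ≤ (l - 1) * k) :
    ∃ g v D j a b, Arranged k (execution (dkdDynamicRing n k) label root G t) g v D j a b ∧
      t + k = (a + b) * k + j := by
  induction t with
  | zero =>
    -- All robots on the root form a line with one node, for which `j = k` by convention.
    refine ⟨fun _ => 0, root, .cw, k, 0, 0, ⟨hk, le_rfl, fun _ => rfl, by simp, ?_, by simp, ?_⟩,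
      by simp⟩
    · intro i h1 h2'
      exact ⟨⟨0, by omega⟩, by push_cast at *; omega⟩
    · intro r; simp [execution]
  | succ t ih =>
    obtain ⟨g, v, D, j, a, b, h, e⟩ := ih (by omega)
    rw [execution_succ]
    rcases h.le.lt_or_eq with hj | rfl
    · obtain ⟨g', v', D', a', b', h', e', hv⟩ := h.exists_head hj
      obtain ⟨v'', h''⟩ := h'.next_reconstruct (label := label) (m := G t) hl hj hv
      exact ⟨g', v'', D', j + 1, a', b', h'', by rw [e']; omega⟩
    · have hm : a + b + 1 < l := by
        by_contra hc
        have : (l - 1) * j ≤ (a + b) * j := Nat.mul_le_mul_right j (by omega)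
        omega
      obtain ⟨g', v', D', a', b', h', e'⟩ :=
        h.next_spread (label := label) (m := G t) hl hlab hm
      refine ⟨g', v', D', 1, a', b', h', ?_⟩
      rw [e', add_mul]; omega

theorem terminatesIn_dkd (hk : 1 ≤ k) (h2 : 2 ≤ l) (hl : l * k ≤ n)
    (hlab : Function.Injective label) :
    TerminatesIn k (execution (dkdDynamicRing n k) label root G) ((l - 1) * k) := by
  have hd : IsDistanceDispersed k
      (execution (dkdDynamicRing n k) label root G ((l - 1) * k)) := by
    obtain ⟨g, v, D, j, a, b, h, e⟩ := exists_arranged (root := root) (G := G) hk h2 hl hlab le_rfl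
    have hc := h.card_le
    have hjk := h.le
    have hf : a + b + 1 = l := by
      by_contra hne
      have : (a + b + 1) * k ≤ (l - 1) * k := Nat.mul_le_mul_right k (by omega)
      rw [add_mul] at this
      omega
    have : l - 1 = a + b := by omega
    rw [this] at e
    obtain rfl : j = k := by omega
    exact h.dispersed hl h2 hf
  refine ⟨⟨hd, fun t ht => ?_⟩, fun T hT => ?_⟩
  · induction t, ht using Nat.le_induction with
    | base => rfl
    | succ t ht ih => rw [execution_succ, ih, next_eq_self hd]
  · by_contra hlt
    push Not at hlt
    obtain ⟨g, v, D, j, a, b, h, e⟩ :=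
      exists_arranged (root := root) (G := G) hk h2 hl hlab hlt.le
    refine h.not_dispersed hl ?_ hT.1
    by_contra hc
    push Not at hc
    have : (l - 1) * k ≤ (a + b) * k := Nat.mul_le_mul_right k (by omega)
    omega

/-! ## The lower bound -/

/-- This lifts the walk of a robot to the integers, where one round changes the coordinate by at
most one. -/
theorem exists_execution_eq_pt (A : Algorithm n) (t : ℕ) (r : Fin l) :
    ∃ z : ℤ, |z| ≤ t ∧ execution A label root G t r = pt root .cw z := by
  induction t with
  | zero => exact ⟨0, by simp, by simp [execution]⟩
  | succ t ih =>
    obtain ⟨z, hz, e⟩ := ih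
    rw [abs_le] at hz
    simp only [execution, moveRobot]
    have stay : ∃ z : ℤ, |z| ≤ (t + 1 : ℕ) ∧ execution A label root G t r = pt root .cw z :=
      ⟨z, by rw [abs_le]; push_cast; omega, e⟩
    split
    · exact stay
    · next D _ =>
      split_ifs
      · exact stay
      · rw [e]
        cases D
        · exact ⟨z + 1, by rw [abs_le]; push_cast; omega, pt_add_step _ _ _⟩
        · exact ⟨z - 1, by rw [abs_le]; push_cast; omega, by simp [pt, Dir.step]; ring⟩

theorem le_of_ringDist {v : ZMod n} {D : Dir} {z w : ℤ} (h : z ≤ w)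
    (hd : k ≤ ringDist (pt v D z) (pt v D w)) (hk : k ≤ n) : (k : ℤ) ≤ w - z := by
  rcases lt_or_ge (w - z) n with hlt | hge
  · rcases h.eq_or_lt with rfl | h
    · simpa [ringDist, dirDist] using hd
    · rw [ringDist_pt h hlt] at hd
      omega
  · omega

/-- Dispersed robots that started on the same node have taken long walks. -/
theorem mul_le_two_mul_of_dispersed (A : Algorithm n) (hk : 1 ≤ k) (hkn : k ≤ n) {T : ℕ}
    (hd : IsDistanceDispersed k (execution A label root G T)) : (l - 1) * k ≤ 2 * T := by
  choose z hz e using exists_execution_eq_pt (label := label) (root := root) (G := G) A T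
  have hsep : ∀ r r', r ≠ r' → z r ≤ z r' → (k : ℤ) ≤ z r' - z r := fun r r' hne hle =>
    le_of_ringDist hle (by rw [← e, ← e]; exact hd.2.1 r r' hne) hkn
  have hk0 : (0 : ℤ) < k := by omega
  -- Cut `[-T, T]` into bins of length `k`: robots at least `k` apart fall into different bins, and
  -- there are `2 * T / k + 1` bins.
  have hinj : Function.Injective fun r => (z r + T) / (k : ℤ) := by
    intro r r' he
    dsimp only at he
    by_contra hne
    have h1 := Int.emod_add_mul_ediv (z r + T) k
    have h2 := Int.emod_add_mul_ediv (z r' + T) k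
    have h3 := Int.emod_nonneg (z r + T) hk0.ne'
    have h4 := Int.emod_nonneg (z r' + T) hk0.ne'
    have h5 := Int.emod_lt_of_pos (z r + T) hk0
    have h6 := Int.emod_lt_of_pos (z r' + T) hk0
    rw [he] at h1
    rcases le_total (z r) (z r') with h | h
    · have := hsep r r' hne h; omega
    · have := hsep r' r (Ne.symm hne) h; omega
  have hcard := Finset.card_le_card_of_injOn (s := Finset.univ) (t := Finset.Icc 0 (2 * T / k : ℤ))
    (fun r => (z r + T) / (k : ℤ)) (fun r _ => by
      have := abs_le.1 (hz r)
      simp only [Finset.coe_Icc, Set.mem_Icc]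
      exact ⟨Int.ediv_nonneg (by omega) hk0.le, Int.ediv_le_ediv hk0 (by omega)⟩) hinj.injOn
  rw [Finset.card_univ, Fintype.card_fin, Int.card_Icc] at hcard
  have h1 : ((l - 1 : ℕ) : ℤ) ≤ 2 * T / k := by
    have : (0 : ℤ) ≤ 2 * T / k := Int.ediv_nonneg (by omega) hk0.le
    omega
  rw [Int.le_ediv_iff_mul_le hk0] at h1
  exact_mod_cast h1

end Execution

end DynRing

/-! ### The constants of the theorem -/

theorem mainTheorem5 :
    ∃ c C : ℝ, 0 < c ∧ 0 < C ∧
      ∀ (n k l : ℕ), 3 ≤ n → 1 ≤ k → 2 ≤ l → l * k ≤ n →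
      ∀ (label : Fin l → ℕ), Function.Injective label →
      ∀ (root : ZMod n) (G : DynRing.DynamicRing n),
        -- the algorithm terminates, in O(n) rounds, and in Ω(n) rounds for the largest `l`
        (∃ T : ℕ,
          DynRing.TerminatesIn k
            (DynRing.execution (DynRing.dkdDynamicRing n k) label root G) T ∧
          (T : ℝ) ≤ C * n ∧
          (l = n / k → c * n ≤ (T : ℝ))) ∧
        -- no algorithm is faster in order of magnitude
        (l = n / k → ∀ (A : DynRing.Algorithm n) (T : ℕ),
          DynRing.TerminatesIn k (DynRing.execution A label root G) T → c * n ≤ (T : ℝ)) := by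
  -- The constant is `1 / 6` because `n ≤ 3 * (l - 1) * k` and, for an arbitrary algorithm, `(l - 1)
  -- * k ≤ 2 * T`.
  refine ⟨1 / 6, 1, by norm_num, by norm_num, fun n k l _ hk h2 hl label hlab root G => ?_⟩
  obtain ⟨l, rfl⟩ : ∃ d, l = d + 1 := ⟨l - 1, by omega⟩
  -- From here on `l` is one less than the number of robots. Maximality gives `n < (l + 2) * k`, and
  -- `l + 2 ≤ 3 * l` because there are at least two robots.
  have hbound : l + 1 = n / k → n ≤ 3 * (l * k) := by
    intro he
    have h1 := Nat.lt_mul_div_succ n hk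
    rw [← he] at h1
    have h3 : 1 * k ≤ l * k := Nat.mul_le_mul_right k (by omega)
    have e : k * (l + 1 + 1) = l * k + k + k := by ring
    omega
  have hterm := DynRing.terminatesIn_dkd (root := root) (G := G) hk h2 hl hlab
  rw [Nat.add_sub_cancel] at hterm
  refine ⟨⟨l * k, hterm, ?_, fun he => ?_⟩, fun he A T hT => ?_⟩
  · rw [one_mul]
    exact_mod_cast (Nat.mul_le_mul_right k (Nat.le_succ l)).trans hl
  · have h3 : (n : ℝ) ≤ 3 * (l * k : ℕ) := by exact_mod_cast hbound he
    have h4 : (0 : ℝ) ≤ (l * k : ℕ) := by positivity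
    linarith
  · have h5 := DynRing.mul_le_two_mul_of_dispersed A hk
      ((Nat.le_mul_of_pos_left k (Nat.succ_pos l)).trans hl) hT.1.1
    rw [Nat.add_sub_cancel] at h5
    have h3 : n ≤ 6 * T := by have := hbound he; omega
    have h4 : (n : ℝ) ≤ 6 * T := by exact_mod_cast h3
    linarith
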